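/- **Automata.** A (max-plus) automaton $\mathcal N=(Q,I,A,\Delta,w,F)$ has a finite set $Q$ of states, a set $I\subseteq Q$ of initial states, a finite alphabet $A$, transitions $\Delta\subseteq Q\times A\times Q$, weights $w:\Delta\to\mathbb Z$, and a set $F\subseteq Q$ of final states; $w_{\max}$ is the maximum of $|w|$ on $\Delta$ ($0$ if $\Delta=\emptyset$). A run on $a_0\cdots a_{n-1}$ is a sequence $q_0a_0q_1\cdots a_{n-1}q_n$ with $(q_i,a_i,q_{i+1})\in\Delta$; it is initial if $q_0\in I$, final if $q_n\in F$, accepting if both; its value is the sum of its weights. $L(\mathcal N)$ is the set of words with an accepting run, and $[\![\mathcal N]\!](\alpha)$ is the maximal value of an accepting run on $\alpha\in L(\mathcal N)$; accepting runs of that value are called maximal. $\mathcal N$ is *trim* if every state is reachable from $I$ and can reach $F$. It is *deterministic* if $|I|=1$ and each $(q,a)$ has at most one $a$-successor. For $B\in\mathbb N$, $\mathcal N$ is *$B$-bounded* if it is trim and for every maximal accepting run $p_0a_0\cdots a_{n-1}p_n$, every $0\le i\le n$ and every initial run $q_0a_0\cdots a_{i-1}q_i$ we have $w(q_0a_0\cdots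 q_i)-w(p_0a_0\cdots p_i)\le B$. $\mathcal N$ is *$r$-regret determinizable* (i.e. $(r,\mathbf{Hom})$-determinizable), $r\in\mathbb N$, if there is a deterministic automaton $\mathcal D$ with a homomorphism to $\mathcal N$ (a map of states that preserves initial states, final states, transitions and their weights) such that $L(\mathcal D)=L(\mathcal N)$ and $|[\![\mathcal N]\!](\alpha)-[\![\mathcal D]\!](\alpha)|\le r$ for all $\alpha\in L(\mathcal N)$; it is *approximately $\mathbf{Hom}$-determinizable* if this holds for some $r\in\mathbb N$. It is *determinizable* if some deterministic $\mathcal D$ has $L(\mathcal D)=L(\mathcal N)$ and $[\![\mathcal D]\!]=[\![\mathcal N]\!]$. **Joker game.** The game on $\mathcal N$ has vertex set $V=V_\exists\cup V_\forall$, where $V_\exists=(Q^2\times A)\cup\{\bot\}$ belongs to Eve and $V_\forall=Q^2\cup(Q^3\times A)$ to Adam, and the following edges with weights $\mu$ ($\mu=0$ where none is given): * $(p,q)\to(p,q,a)$ if $q$ has an $a$-successor; * $(p,q,a)\to(p,q,p',a)$ if $(p,a,p')\in\Delta$; * $(p,q,p',a)\to(p',q')$ if $(p,a,p'),(q,a,q')\in\Delta$,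 of weight $w(p,a,p')-w(q,a,q')$; * reset ("joker") edges $(p,q,p',a)\to(p',p'')$ if $(p,a,p'),(p,a,p'')\in\Delta$, of weight $w(p,a,p')-w(p,a,p'')$; * $(p,q)\to\bot$ if $p\notin F$ and $q\in F$, or if for some $a\in A$ the state $q$ has an $a$-successor and $p$ has none; * $\bot\to\bot$ of weight $-1$. A reset edge and an ordinary edge with the same end points are different edges. $\mu_{\max}$ is the maximum of $|\mu|$ over all edges. The energy level of a finite path with initial credit $c_0\in\mathbb N$ is $c_0$ plus the weights of its edges from the last reset edge on (included), or of all its edges if there is no reset edge. Eve wins from a vertex $v$ with initial credit $c_0$ if she has a (history-dependent) strategy, giving her a legal move whenever it is her turn, such that all finite prefixes of all plays from $v$ consistent with it have energy level $\ge0$ (a play ends when Adam has no move). *Eve wins the Joker game on $\mathcal N$* if there is $p\in I$ such that for all $q\in I$ she wins from $(p,q)$ with initial credit $|V|\mu_{\max}$. **Theorem.** 1. There is a polynomial $P\in\mathbb N[x,y]$, the same for all alphabets and automata, such that for every trim automaton $\mathcal N=(Q,I,A,\Delta,w,F)$ on which Eve wins the Joker game, $\mathcal N$ is $2|V|\mu_{\max}$-bounded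 and there is a deterministic automaton $\mathcal D$ with $L(\mathcal D)=L(\mathcal N)$ and $[\![\mathcal D]\!]=[\![\mathcal N]\!]$ that has at most $P(|Q|,w_{\max})^{|Q|}$ states, at most $|A|\cdot P(|Q|,w_{\max})^{|Q|}$ transitions, and all of whose weights have absolute value at most $P(|Q|,w_{\max})$. (So its size and weights are polynomial in $w_{\max}$ and exponential in $|Q|$.) 2. If a trim automaton $\mathcal N$ is $r$-regret determinizable for some $r\in\mathbb N$, then Eve wins the Joker game on $\mathcal N$. 3. Every approximately $\mathbf{Hom}$-determinizable automaton (trim or not) is determinizable. -/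

import Mathlib

universe u v

/-- A (nondeterministic, max-plus) weighted automaton with alphabet `A` and set of states `Q`.
The weight function is only meaningful on `Δ`: its values outside `Δ` are never used. -/
structure WAut (A : Type*) (Q : Type*) where
  /-- initial states -/
  I : Set Q
  /-- transitions -/
  Δ : Set (Q × A × Q)
  /-- weights of the transitions -/
  w : Q × A × Q → ℤ
  /-- final states -/
  F : Set Q

namespace WAut

variable {A : Type*} {Q : Type*} {Q' : Type*}

/-- `N.IsRun q ρ`: the sequence `q a₀ q₁ a₁ q₂ … aₙ₋₁ qₙ` is a run, where
`ρ = [(a₀, q₁), (a₁, q₂), …, (aₙ₋₁, qₙ)]`. -/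
def IsRun (N : WAut A Q) : Q → List (A × Q) → Prop
  | _, [] => True
  | q, (a, q') :: ρ => (q, a, q') ∈ N.Δ ∧ N.IsRun q' ρ

/-- The last state of the sequence `q ρ`. -/
def lastState : Q → List (A × Q) → Q
  | q, [] => q
  | _, (_, q') :: ρ => lastState q' ρ

/-- The value of a run: the sum of the weights of its transitions. -/
def runWeight (N : WAut A Q) : Q → List (A × Q) → ℤ
  | _, [] => 0
  | q, (a, q') :: ρ => N.w (q, a, q') + N.runWeight q' ρ

/-- The word that a sequence is labelled with. -/
def word (ρ : List (A × Q)) : List A := ρ.map Prod.fst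

/-- Accepting runs: initial and final. -/
def IsAccepting (N : WAut A Q) (q : Q) (ρ : List (A × Q)) : Prop :=
  q ∈ N.I ∧ N.IsRun q ρ ∧ lastState q ρ ∈ N.F

/-- The (unweighted) language of the automaton. -/
def language (N : WAut A Q) : Set (List A) :=
  {α | ∃ q ρ, N.IsAccepting q ρ ∧ word ρ = α}

/-- The values of the accepting runs on `α`. -/
def values (N : WAut A Q) (α : List A) : Set ℤ :=
  {x | ∃ q ρ, N.IsAccepting q ρ ∧ word ρ = α ∧ N.runWeight q ρ = x}

/-- The function `⟦N⟧` defined by the automaton: the maximal value of an accepting run.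
Only meaningful on words of the language, where it is a maximum (`isGreatest_eval`). -/
noncomputable def eval (N : WAut A Q) (α : List A) : ℤ := sSup (N.values α)

theorem finite_runWeights [Finite Q] (N : WAut A Q) (α : List A) (q : Q) :
    {x : ℤ | ∃ ρ : List (A × Q), word ρ = α ∧ N.runWeight q ρ = x}.Finite := by
  induction α generalizing q with
  | nil =>
    refine (Set.finite_singleton (0 : ℤ)).subset ?_
    rintro x ⟨ρ, hρ, rfl⟩
    cases ρ with
    | nil => simp [runWeight]
    | cons s ρ => simp [word] at hρ
  | cons a α ih =>
    refine (Set.finite_iUnion fun q' : Q =>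
      (ih q').image fun x => N.w (q, a, q') + x).subset ?_
    rintro x ⟨ρ, hρ, rfl⟩
    cases ρ with
    | nil => simp [word] at hρ
    | cons s ρ =>
      obtain ⟨b, q'⟩ := s
      simp only [word, List.map_cons, List.cons.injEq] at hρ
      obtain ⟨rfl, hρ⟩ := hρ
      exact Set.mem_iUnion.2 ⟨q', _, ⟨ρ, hρ, rfl⟩, rfl⟩

theorem isGreatest_eval [Finite Q] (N : WAut A Q) {α : List A} (hα : α ∈ N.language) :
    IsGreatest (N.values α) (N.eval α) := by
  have hfin : (N.values α).Finite := by
    refine (Set.finite_iUnion fun q : Q => N.finite_runWeights α q).subset ?_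
    rintro x ⟨q, ρ, -, hw, hx⟩
    exact Set.mem_iUnion.2 ⟨q, ρ, hw, hx⟩
  have hne : (N.values α).Nonempty := by
    obtain ⟨q, ρ, h, hw⟩ := hα
    exact ⟨_, q, ρ, h, hw, rfl⟩
  exact ⟨hne.csSup_mem hfin, fun x hx => le_csSup hfin.bddAbove hx⟩

/-- Two automata define the same (partial) function. -/
def Equivalent (N : WAut A Q) (D : WAut A Q') : Prop :=
  N.language = D.language ∧ ∀ α ∈ N.language, N.eval α = D.eval α

open Classical in
/-- `w_max`, the maximal absolute value of the weight of a transition. -/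
noncomputable def wMax [Fintype A] [Fintype Q] (N : WAut A Q) : ℕ :=
  (Finset.univ.filter fun t : Q × A × Q => t ∈ N.Δ).sup fun t => (N.w t).natAbs

def IsDeterministic (N : WAut A Q) : Prop :=
  (∃ q, N.I = {q}) ∧
    ∀ q a q₁ q₂, (q, a, q₁) ∈ N.Δ → (q, a, q₂) ∈ N.Δ → q₁ = q₂

/-- Every state is reachable from an initial state and can reach a final state. -/
def IsTrim (N : WAut A Q) : Prop :=
  ∀ q, (∃ q₀ ∈ N.I, ∃ ρ, N.IsRun q₀ ρ ∧ lastState q₀ ρ = q) ∧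
    ∃ ρ, N.IsRun q ρ ∧ lastState q ρ ∈ N.F

/-- `N` is `B`-bounded: it is trim and, for every maximal accepting run `p ρ`, every position `i`
of it, and every initial run `q ρ'` on the prefix of length `i` of the word of `ρ`, the value of
`q ρ'` exceeds that of the prefix of length `i` of `p ρ` by at most `B`. -/
def IsBounded (N : WAut A Q) (B : ℕ) : Prop :=
  N.IsTrim ∧
    ∀ (p : Q) (ρ : List (A × Q)),
      N.IsAccepting p ρ → N.runWeight p ρ = N.eval (word ρ) →
      ∀ i ≤ ρ.length, ∀ (q : Q) (ρ' : List (A × Q)),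
        q ∈ N.I → N.IsRun q ρ' → word ρ' = word (ρ.take i) →
        N.runWeight q ρ' - N.runWeight p (ρ.take i) ≤ B

/-- `h` is a homomorphism from `D` to `N`. -/
structure IsHom (D : WAut A Q') (N : WAut A Q) (h : Q' → Q) : Prop where
  init : ∀ q ∈ D.I, h q ∈ N.I
  final : ∀ q ∈ D.F, h q ∈ N.F
  trans : ∀ p a q, (p, a, q) ∈ D.Δ → (h p, a, h q) ∈ N.Δ
  weight : ∀ p a q, (p, a, q) ∈ D.Δ → N.w (h p, a, h q) = D.w (p, a, q)

/-- `N` is `r`-regret determinizable, that is, `(r, Hom)`-determinizable. -/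
def IsRegretDeterminizable (N : WAut A Q) (r : ℕ) : Prop :=
  ∃ (Q' : Type) (_ : Fintype Q') (D : WAut A Q'),
    D.IsDeterministic ∧ (∃ h : Q' → Q, D.IsHom N h) ∧ N.language = D.language ∧
      ∀ α ∈ N.language, |N.eval α - D.eval α| ≤ (r : ℤ)

/-- `N` is approximately `Hom`-determinizable. -/
def IsApproxHomDeterminizable (N : WAut A Q) : Prop := ∃ r : ℕ, N.IsRegretDeterminizable r

/-- `N` is (exactly) determinizable. -/
def IsDeterminizable (N : WAut A Q) : Prop :=
  ∃ (Q' : Type) (_ : Fintype Q') (D : WAut A Q'), D.IsDeterministic ∧ N.Equivalent D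

end WAut

/-- An energy game with resets. An edge is a triple `(u, b, v)` from `u` to `v`, and it is a reset
edge if `b = true`; thus a reset edge and an ordinary edge may have the same end points. Weights are
only meaningful on edges. -/
structure EnergyGame (V : Type*) where
  /-- the vertices of Eve; the other ones belong to Adam -/
  eve : Set V
  /-- the edges -/
  E : Set (V × Bool × V)
  /-- the weights of the edges -/
  μ : V × Bool × V → ℤ
  /-- reset edges leave vertices of Adam -/
  reset_adam : ∀ u v, (u, true, v) ∈ E → u ∉ eve

namespace EnergyGame

variable {V : Type*}

open Classical in
/-- `μ_max`, the maximal absolute value of the weight of an edge. -/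
noncomputable def μMax [Fintype V] (G : EnergyGame V) : ℕ :=
  (Finset.univ.filter fun e : V × Bool × V => e ∈ G.E).sup fun e => (G.μ e).natAbs

/-- The last vertex of a path from `v`; a path is given as the list of the (flag, target) pairs of
its edges. -/
def lastVertex : V → List (Bool × V) → V
  | v, [] => v
  | _, (_, u) :: φ => lastVertex u φ

/-- The energy after the path `φ` from `v` when the current energy is `e`: a reset edge sets the
energy to `c₀`, and then every edge adds its weight. -/
def energyFrom (G : EnergyGame V) (c₀ : ℤ) : V → ℤ → List (Bool × V) → ℤ
  | _, e, [] => e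
  | v, e, (b, u) :: φ => G.energyFrom c₀ u ((if b then c₀ else e) + G.μ (v, b, u)) φ

/-- The energy level of the path `φ` from `v` with initial credit `c₀`: the initial credit plus the
weights of all edges from the last reset edge (included) on. -/
def energyLevel (G : EnergyGame V) (c₀ : ℕ) (v : V) (φ : List (Bool × V)) : ℤ :=
  G.energyFrom c₀ v c₀ φ

/-- The finite paths from `v` that are consistent with Eve's strategy `σ`, which maps the path
followed so far to the next vertex; these are the finite prefixes of the plays from `v` of `σ`
against all strategies of Adam. -/
inductive Consistent (G : EnergyGame V) (σ : List (Bool × V) → V) (v : V) :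
    List (Bool × V) → Prop
  | nil : Consistent G σ v []
  | eve (φ : List (Bool × V)) : Consistent G σ v φ → lastVertex v φ ∈ G.eve →
      (lastVertex v φ, false, σ φ) ∈ G.E → Consistent G σ v (φ ++ [(false, σ φ)])
  | adam (φ : List (Bool × V)) (b : Bool) (u : V) : Consistent G σ v φ →
      lastVertex v φ ∉ G.eve → (lastVertex v φ, b, u) ∈ G.E → Consistent G σ v (φ ++ [(b, u)])

/-- Eve wins from `v` with initial credit `c₀`: she has a strategy that always provides her with a
legal move and that never lets the energy level become negative. (A play that reaches a vertex of
Adam without outgoing edges ends there.) -/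
def EveWinsFrom (G : EnergyGame V) (v : V) (c₀ : ℕ) : Prop :=
  ∃ σ : List (Bool × V) → V, ∀ φ, G.Consistent σ v φ →
    (lastVertex v φ ∈ G.eve → (lastVertex v φ, false, σ φ) ∈ G.E) ∧ 0 ≤ G.energyLevel c₀ v φ

end EnergyGame

/-- The vertices of the Joker game. -/
inductive JokerVertex (A : Type*) (Q : Type*)
  /-- the configuration `(p, q)`, with `p` Eve's state and `q` Adam's -/
  | conf (p q : Q)
  /-- `(p, q, a)`: Adam has chosen the symbol `a` -/
  | symb (p q : Q) (a : A)
  /-- `(p, q, p', a)`: Eve has chosen the transition `(p, a, p')` -/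
  | resp (p q p' : Q) (a : A)
  /-- the vertex `⊥`, where Eve loses -/
  | bot

namespace JokerVertex

variable {A : Type*} {Q : Type*}

def equivSum (A Q : Type*) :
    JokerVertex A Q ≃ ((Q × Q) ⊕ (Q × Q × A)) ⊕ ((Q × Q × Q × A) ⊕ Unit) where
  toFun
    | conf p q => .inl (.inl (p, q))
    | symb p q a => .inl (.inr (p, q, a))
    | resp p q p' a => .inr (.inl (p, q, p', a))
    | bot => .inr (.inr ())
  invFun
    | .inl (.inl (p, q)) => conf p q
    | .inl (.inr (p, q, a)) => symb p q a
    | .inr (.inl (p, q, p', a)) => resp p q p' a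
    | .inr (.inr ()) => bot
  left_inv x := by cases x <;> rfl
  right_inv x := by rcases x with (⟨_, _⟩ | ⟨_, _, _⟩) | (⟨_, _, _, _⟩ | ⟨⟩) <;> rfl

instance [Fintype A] [Fintype Q] : Fintype (JokerVertex A Q) :=
  Fintype.ofEquiv _ (equivSum A Q).symm

end JokerVertex

namespace WAut

variable {A : Type*} {Q : Type*}

open JokerVertex

/-- The edges of the Joker game on `N`. -/
inductive JokerEdge (N : WAut A Q) : JokerVertex A Q → Bool → JokerVertex A Q → Prop
  /-- Adam chooses a symbol that he can read. -/
  | symb (p q : Q) (a : A) (q' : Q) : (q, a, q') ∈ N.Δ →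
      JokerEdge N (conf p q) false (symb p q a)
  /-- Eve chooses a transition. -/
  | resp (p q : Q) (a : A) (p' : Q) : (p, a, p') ∈ N.Δ →
      JokerEdge N (symb p q a) false (resp p q p' a)
  /-- Adam chooses a transition from his own state. -/
  | follow (p q p' : Q) (a : A) (q' : Q) : (p, a, p') ∈ N.Δ → (q, a, q') ∈ N.Δ →
      JokerEdge N (resp p q p' a) false (conf p' q')
  /-- Adam plays joker and chooses a transition from Eve's state. -/
  | joker (p q p' : Q) (a : A) (p'' : Q) : (p, a, p') ∈ N.Δ → (p, a, p'') ∈ N.Δ →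
      JokerEdge N (resp p q p' a) true (conf p' p'')
  /-- Adam's state is final and Eve's is not. -/
  | notFinal (p q : Q) : p ∉ N.F → q ∈ N.F → JokerEdge N (conf p q) false bot
  /-- Adam can read a symbol that Eve cannot. -/
  | stuck (p q : Q) (a : A) (q' : Q) : (q, a, q') ∈ N.Δ → (∀ p', (p, a, p') ∉ N.Δ) →
      JokerEdge N (conf p q) false bot
  | loop : JokerEdge N bot false bot

/-- The weights of the edges of the Joker game on `N`. -/
def jokerWeight (N : WAut A Q) : JokerVertex A Q × Bool × JokerVertex A Q → ℤ
  | (bot, _, _) => -1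
  | (resp p q p' a, false, conf _ q') => N.w (p, a, p') - N.w (q, a, q')
  | (resp p _ p' a, true, conf _ p'') => N.w (p, a, p') - N.w (p, a, p'')
  | _ => 0

/-- The Joker game on `N`, as an energy game with resets. -/
def jokerGame (N : WAut A Q) : EnergyGame (JokerVertex A Q) where
  eve := {v | v = bot ∨ ∃ p q a, v = symb p q a}
  E := {e | N.JokerEdge e.1 e.2.1 e.2.2}
  μ := N.jokerWeight
  reset_adam := by
    rintro u v h
    cases h
    simp

/-- `|V| · μ_max` for the Joker game on `N`. -/
noncomputable def jokerCredit [Fintype A] [Fintype Q] (N : WAut A Q) : ℕ :=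
  Fintype.card (JokerVertex A Q) * N.jokerGame.μMax

/-- Eve wins the Joker game on `N`. -/
def EveWinsJoker [Fintype A] [Fintype Q] (N : WAut A Q) : Prop :=
  ∃ p ∈ N.I, ∀ q ∈ N.I, N.jokerGame.EveWinsFrom (conf p q) N.jokerCredit

end WAut

/-! The proof replaces the game by the relation `Simulates p q e`: Eve survives from (p, q) with
energy e if every joker grants her whatever energy she then needs. Only the finitely many least
sufficient energies V(p, q) matter, and shrinking the gaps between them to at most μ_max keeps all
constraints of the game, so each is at most |Q|²μ_max (`exists_rank`). The fixed credit |V|μ_max is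
therefore no restriction: `exists_simulates_of_eveWinsFrom` and `Simulates.eveWinsFrom` translate
between the two notions.

Part 1. A joker lets Adam take any alternative to Eve's transition, so the state she chooses
simulates all other successors of her old state. The relation is transitive (`Simulates.trans`), so
whichever run she answers, her state goes on simulating every state reachable on the word read
(`Simulates.exists_run`). She may thus answer an arbitrary initial run up to some position and from
there the rest of a maximal accepting run. Each phase costs at most M = |Q|²μ_max and the result is
an accepting run, hence no better than the maximal one; this gives 2M-boundedness. A B-bounded
automaton is determinized by a subset construction that stores, relative to a reference value, the
best value at each state, and drops states more than B below the best: they lie on no maximal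
accepting run (`IsTracking.step`).

Part 2. Eve plays the image of the run of the deterministic automaton. Since any run of a trim
automaton can be completed by a word of bounded length, bounded regret keeps her within a constant
of every initial run on the same word; a joker merely exchanges one such run for another.

Part 3. Trim both automata, then combine parts 2 and 1. -/

namespace WAut

variable {A : Type*} {Q : Type*} {Q' : Type*}

/-! ### Runs, determinism and homomorphisms -/

section Runs

theorem lastState_append (q : Q) (ρ₁ ρ₂ : List (A × Q)) :
    lastState q (ρ₁ ++ ρ₂) = lastState (lastState q ρ₁) ρ₂ := by
  induction ρ₁ generalizing q with
  | nil => rfl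
  | cons s ρ ih => exact ih s.2

theorem isRun_append (N : WAut A Q) (q : Q) (ρ₁ ρ₂ : List (A × Q)) :
    N.IsRun q (ρ₁ ++ ρ₂) ↔ N.IsRun q ρ₁ ∧ N.IsRun (lastState q ρ₁) ρ₂ := by
  induction ρ₁ generalizing q with
  | nil => simp [IsRun, lastState]
  | cons s ρ ih =>
    obtain ⟨a, q'⟩ := s
    simp only [List.cons_append, IsRun, lastState, ih, and_assoc]

theorem runWeight_append (N : WAut A Q) (q : Q) (ρ₁ ρ₂ : List (A × Q)) :
    N.runWeight q (ρ₁ ++ ρ₂) = N.runWeight q ρ₁ + N.runWeight (lastState q ρ₁) ρ₂ := by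
  induction ρ₁ generalizing q with
  | nil => simp [runWeight, lastState]
  | cons s ρ ih =>
    obtain ⟨a, q'⟩ := s
    simp only [List.cons_append, runWeight, lastState, ih, add_assoc]

theorem word_append (ρ₁ ρ₂ : List (A × Q)) : word (ρ₁ ++ ρ₂) = word ρ₁ ++ word ρ₂ :=
  List.map_append

theorem isRun_concat (N : WAut A Q) (q : Q) (ρ : List (A × Q)) (a : A) (q' : Q) :
    N.IsRun q (ρ ++ [(a, q')]) ↔ N.IsRun q ρ ∧ (lastState q ρ, a, q') ∈ N.Δ := by
  simp [isRun_append, IsRun]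

theorem runWeight_concat (N : WAut A Q) (q : Q) (ρ : List (A × Q)) (a : A) (q' : Q) :
    N.runWeight q (ρ ++ [(a, q')]) = N.runWeight q ρ + N.w (lastState q ρ, a, q') := by
  simp [runWeight_append, runWeight]

theorem lastState_concat (q : Q) (ρ : List (A × Q)) (a : A) (q' : Q) :
    lastState q (ρ ++ [(a, q')]) = q' := by
  simp [lastState_append, lastState]

theorem natAbs_le_wMax [Fintype A] [Fintype Q] (N : WAut A Q) {t : Q × A × Q} (ht : t ∈ N.Δ) :
    (N.w t).natAbs ≤ N.wMax := by
  classical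
  unfold wMax
  exact Finset.le_sup (f := fun t => (N.w t).natAbs) (by simpa using ht)

theorem abs_runWeight_le [Fintype A] [Fintype Q] (N : WAut A Q) (q : Q) (ρ : List (A × Q))
    (h : N.IsRun q ρ) : |N.runWeight q ρ| ≤ ρ.length * N.wMax := by
  induction ρ generalizing q with
  | nil => simp [runWeight]
  | cons s ρ ih =>
    obtain ⟨a, q'⟩ := s
    have h1 := N.natAbs_le_wMax h.1
    have h2 := ih q' h.2
    have h3 : |N.w (q, a, q')| ≤ N.wMax := by rw [Int.abs_eq_natAbs]; exact_mod_cast h1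
    have h4 := abs_add_le (N.w (q, a, q')) (N.runWeight q' ρ)
    simp only [runWeight, List.length_cons]
    push_cast
    linarith

theorem runWeight_le_eval [Finite Q] (N : WAut A Q) {q : Q} {ρ : List (A × Q)}
    (h : N.IsAccepting q ρ) : N.runWeight q ρ ≤ N.eval (word ρ) :=
  (N.isGreatest_eval ⟨q, ρ, h, rfl⟩).2 ⟨q, ρ, h, rfl, rfl⟩

theorem exists_runWeight_eq_eval [Finite Q] (N : WAut A Q) {α : List A} (h : α ∈ N.language) :
    ∃ q ρ, N.IsAccepting q ρ ∧ word ρ = α ∧ N.runWeight q ρ = N.eval α :=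
  (N.isGreatest_eval h).1

theorem eval_eq_of_values_eq {N : WAut A Q} {D : WAut A Q'} {α : List A}
    (h : N.values α = D.values α) : N.eval α = D.eval α := by
  rw [eval, eval, h]

theorem mem_language_iff (N : WAut A Q) (α : List A) : α ∈ N.language ↔ (N.values α).Nonempty :=
  ⟨fun ⟨q, ρ, h, hw⟩ => ⟨_, q, ρ, h, hw, rfl⟩, fun ⟨_, q, ρ, h, hw, _⟩ => ⟨q, ρ, h, hw⟩⟩

theorem IsDeterministic.run_unique {D : WAut A Q} (hD : D.IsDeterministic) {q : Q}
    {ρ ρ' : List (A × Q)} (h : D.IsRun q ρ) (h' : D.IsRun q ρ') (hw : word ρ = word ρ') :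
    ρ = ρ' := by
  induction ρ generalizing q ρ' with
  | nil =>
    cases ρ' with
    | nil => rfl
    | cons s ρ' => simp [word] at hw
  | cons s ρ ih =>
    cases ρ' with
    | nil => simp [word] at hw
    | cons s' ρ' =>
      obtain ⟨a, p⟩ := s
      obtain ⟨a', p'⟩ := s'
      simp only [word, List.map_cons, List.cons.injEq] at hw
      obtain ⟨rfl, hw⟩ := hw
      obtain rfl := hD.2 _ _ _ _ h.1 h'.1
      rw [ih h.2 h'.2 hw]

/-- The image of a sequence under a map of states. -/
def mapRun (h : Q' → Q) (ρ : List (A × Q')) : List (A × Q) := ρ.map fun s => (s.1, h s.2)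

theorem word_mapRun (h : Q' → Q) (ρ : List (A × Q')) : word (mapRun h ρ) = word ρ := by
  simp [word, mapRun]

theorem lastState_mapRun (h : Q' → Q) (q : Q') (ρ : List (A × Q')) :
    lastState (h q) (mapRun h ρ) = h (lastState q ρ) := by
  induction ρ generalizing q with
  | nil => rfl
  | cons s ρ ih => exact ih s.2

theorem IsHom.isRun {D : WAut A Q'} {N : WAut A Q} {h : Q' → Q} (hh : D.IsHom N h) {q : Q'}
    {ρ : List (A × Q')} (hr : D.IsRun q ρ) :
    N.IsRun (h q) (mapRun h ρ) ∧ N.runWeight (h q) (mapRun h ρ) = D.runWeight q ρ := by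
  induction ρ generalizing q with
  | nil => exact ⟨trivial, rfl⟩
  | cons s ρ ih =>
    obtain ⟨a, q'⟩ := s
    obtain ⟨h1, h2⟩ := ih hr.2
    refine ⟨⟨hh.trans _ _ _ hr.1, h1⟩, ?_⟩
    change N.w (h q, a, h q') + N.runWeight (h q') (mapRun h ρ) = _
    rw [hh.weight _ _ _ hr.1, h2]
    rfl

end Runs

/-! ### The simulation relation of the Joker game and its energy bound -/

section Simulation

/-- A set of triples `(p, q, e)` such that, with energy `e` at `(p, q)`, Eve can play a round of the
Joker game after which the configuration is again in the set: with at most the energy she then has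
if Adam moves from his own state, and with any energy if Adam plays joker. -/
def IsSimulation (N : WAut A Q) (Y : Q → Q → ℕ → Prop) : Prop :=
  ∀ p q e, Y p q e → (q ∈ N.F → p ∈ N.F) ∧
    ∀ a, (∃ q', (q, a, q') ∈ N.Δ) → ∃ p', (p, a, p') ∈ N.Δ ∧
      (∀ q', (q, a, q') ∈ N.Δ →
        ∃ e', Y p' q' e' ∧ (e' : ℤ) ≤ e + N.w (p, a, p') - N.w (q, a, q')) ∧
      ∀ p'', (p, a, p'') ∈ N.Δ → ∃ e', Y p' p'' e'

/-- `(p, q, e)` belongs to some set of triples closed under rounds of the Joker game. -/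
def Simulates (N : WAut A Q) (p q : Q) (e : ℕ) : Prop := ∃ Y, N.IsSimulation Y ∧ Y p q e

/-- A union of simulations is a simulation, so `Simulates` is the greatest one and can be unfolded
round by round. -/
theorem isSimulation_simulates (N : WAut A Q) : N.IsSimulation N.Simulates := by
  rintro p q e ⟨Y, hY, h⟩
  obtain ⟨hF, hs⟩ := hY p q e h
  refine ⟨hF, fun a ha => ?_⟩
  obtain ⟨p', hp', h1, h2⟩ := hs a ha
  refine ⟨p', hp', fun q' hq' => ?_, fun p'' hp'' => ?_⟩
  · obtain ⟨e', he', hle⟩ := h1 q' hq'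
    exact ⟨e', ⟨Y, hY, he'⟩, hle⟩
  · obtain ⟨e', he'⟩ := h2 p'' hp''
    exact ⟨e', Y, hY, he'⟩

/-- Eve keeps a middle token at q, moved by the second strategy, and lets the first strategy answer
that token; energies add up. A joker is answered by the first strategy alone, which is why plain
`Simulates` is joined to the composite relation. -/
theorem Simulates.trans {N : WAut A Q} {p q r : Q} {e f : ℕ} (h : N.Simulates p q e)
    (h' : N.Simulates q r f) : N.Simulates p r (e + f) := by
  refine ⟨fun p r g => N.Simulates p r g ∨
    ∃ q e f, N.Simulates p q e ∧ N.Simulates q r f ∧ g = e + f, ?_, .inr ⟨q, e, f, h, h', rfl⟩⟩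
  rintro p r g (h | ⟨q, e, f, h, h', rfl⟩)
  · obtain ⟨hF, hs⟩ := N.isSimulation_simulates _ _ _ h
    refine ⟨hF, fun a ha => ?_⟩
    obtain ⟨p', hp', h1, h2⟩ := hs a ha
    refine ⟨p', hp', fun q' hq' => ?_, fun p'' hp'' => ?_⟩
    · obtain ⟨e', he', hle⟩ := h1 q' hq'
      exact ⟨e', .inl he', hle⟩
    · obtain ⟨e', he'⟩ := h2 p'' hp''
      exact ⟨e', .inl he'⟩
  · obtain ⟨hF, hs⟩ := N.isSimulation_simulates _ _ _ h
    obtain ⟨hF', hs'⟩ := N.isSimulation_simulates _ _ _ h'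
    refine ⟨fun hr => hF (hF' hr), fun a ha => ?_⟩
    obtain ⟨q', hq', k1, -⟩ := hs' a ha
    obtain ⟨p', hp', h1, h2⟩ := hs a ⟨q', hq'⟩
    obtain ⟨e', he', hle⟩ := h1 q' hq'
    refine ⟨p', hp', fun r' hr' => ?_, fun p'' hp'' => ?_⟩
    · obtain ⟨f', hf', hlf⟩ := k1 r' hr'
      exact ⟨e' + f', .inr ⟨q', e', f', he', hf', rfl⟩, by push_cast; linarith⟩
    · obtain ⟨e', he'⟩ := h2 p'' hp''
      exact ⟨e', .inl he'⟩

/-- The number of naturals below `v` that lie in one of the intervals `[s, s + m)` with `s ∈ S`. -/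
def coveredBelow (S : Finset ℕ) (m v : ℕ) : ℕ :=
  ((Finset.range v).filter fun t => ∃ s ∈ S, s ≤ t ∧ t < s + m).card

theorem coveredBelow_le (S : Finset ℕ) (m v : ℕ) : coveredBelow S m v ≤ S.card * m := by
  have : ((Finset.range v).filter fun t => ∃ s ∈ S, s ≤ t ∧ t < s + m) ⊆
      S.biUnion fun s => Finset.Ico s (s + m) := by
    intro t ht
    simp only [Finset.mem_filter] at ht
    simpa using ht.2
  refine (Finset.card_le_card this).trans (Finset.card_biUnion_le_card_mul _ _ _ ?_)
  intro s _
  simp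

theorem coveredBelow_mono (S : Finset ℕ) (m : ℕ) : Monotone (coveredBelow S m) := by
  intro u v huv
  refine Finset.card_le_card (Finset.filter_subset_filter _ ?_)
  exact Finset.range_subset_range.2 huv

theorem coveredBelow_add_le (S : Finset ℕ) (m u d : ℕ) :
    coveredBelow S m (u + d) ≤ coveredBelow S m u + d := by
  have : ((Finset.range (u + d)).filter fun t => ∃ s ∈ S, s ≤ t ∧ t < s + m) ⊆
      ((Finset.range u).filter fun t => ∃ s ∈ S, s ≤ t ∧ t < s + m) ∪ Finset.Ico u (u + d) := by
    intro t ht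
    simp only [Finset.mem_filter, Finset.mem_range, Finset.mem_union, Finset.mem_Ico] at ht ⊢
    by_cases h : t < u
    · exact .inl ⟨h, ht.2⟩
    · exact .inr ⟨by omega, ht.1⟩
  refine (Finset.card_le_card this).trans ((Finset.card_union_le _ _).trans ?_)
  simp [coveredBelow]

theorem le_coveredBelow_add {S : Finset ℕ} {m u d : ℕ} (hu : u ∈ S) (hd : d ≤ m) :
    coveredBelow S m u + d ≤ coveredBelow S m (u + d) := by
  have hdisj : Disjoint ((Finset.range u).filter fun t => ∃ s ∈ S, s ≤ t ∧ t < s + m)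
      (Finset.Ico u (u + d)) := by
    rw [Finset.disjoint_left]
    intro t ht ht'
    simp only [Finset.mem_filter, Finset.mem_range, Finset.mem_Ico] at ht ht'
    omega
  have : ((Finset.range u).filter fun t => ∃ s ∈ S, s ≤ t ∧ t < s + m) ∪ Finset.Ico u (u + d) ⊆
      ((Finset.range (u + d)).filter fun t => ∃ s ∈ S, s ≤ t ∧ t < s + m) := by
    intro t ht
    simp only [Finset.mem_filter, Finset.mem_range, Finset.mem_union, Finset.mem_Ico] at ht ⊢
    rcases ht with ht | ht
    · exact ⟨by omega, ht.2⟩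
    · exact ⟨ht.2, u, hu, ht.1, by omega⟩
  have h := Finset.card_le_card this
  rw [Finset.card_union_of_disjoint hdisj] at h
  simpa [coveredBelow] using h

/-- Shrinking the gaps between the elements of `S` to at most `m` preserves energy constraints
whose weight is at least `-m`. -/
theorem coveredBelow_le_add {S : Finset ℕ} {m x y : ℕ} {z : ℤ} (hy : y ∈ S) (hz : -(m : ℤ) ≤ z)
    (h : (y : ℤ) ≤ x + z) : (coveredBelow S m y : ℤ) ≤ coveredBelow S m x + z := by
  -- Upward distances do not grow under compression. A required drop of `-z ≤ m` survives, since the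
  -- whole interval of that length starting at `y ∈ S` is counted.
  rcases le_total x y with hxy | hxy
  · obtain ⟨d, rfl⟩ := Nat.exists_eq_add_of_le hxy
    have := coveredBelow_add_le S m x d
    omega
  · rcases le_total 0 z with h0 | h0
    · have := coveredBelow_mono S m hxy
      omega
    · have h1 := le_coveredBelow_add (S := S) (m := m) (d := (-z).toNat) hy (by omega)
      have h2 := coveredBelow_mono S m (show y + (-z).toNat ≤ x by omega)
      omega

/-- If Eve can simulate with some initial energy, then she can do so with energy at most
`|Q|² m`, where `m` bounds the weights. -/
theorem exists_rank [Fintype Q] (N : WAut A Q) (m : ℕ)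
    (hm : ∀ p q a p' q', (p, a, p') ∈ N.Δ → (q, a, q') ∈ N.Δ →
      -(m : ℤ) ≤ N.w (p, a, p') - N.w (q, a, q')) {p q : Q} {e : ℕ} (h : N.Simulates p q e) :
    ∃ e' ≤ Fintype.card Q ^ 2 * m, N.Simulates p q e' := by
  classical
  let V : Q → Q → ℕ := fun p q => sInf {e | N.Simulates p q e}
  have hV : ∀ {p q e}, N.Simulates p q e → N.Simulates p q (V p q) ∧ V p q ≤ e := fun h =>
    ⟨Nat.sInf_mem (s := {e | N.Simulates _ _ e}) ⟨_, h⟩, Nat.sInf_le h⟩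
  let S : Finset ℕ := Finset.univ.image fun s : Q × Q => V s.1 s.2
  have hS : ∀ p q, V p q ∈ S := fun p q => Finset.mem_image.2 ⟨(p, q), Finset.mem_univ _, rfl⟩
  have hcard : S.card ≤ Fintype.card Q ^ 2 := by
    refine Finset.card_image_le.trans ?_
    simp [sq]
  -- The least energies satisfy the constraints of the game; the compressed ones still do, and are
  -- bounded by the number of intervals times `m`.
  refine ⟨coveredBelow S m (V p q),
    (coveredBelow_le _ _ _).trans (Nat.mul_le_mul_right _ hcard),
    fun p q e => (∃ f, N.Simulates p q f) ∧ e = coveredBelow S m (V p q), ?_, ⟨e, h⟩, rfl⟩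
  rintro p q e ⟨⟨f, hf⟩, rfl⟩
  obtain ⟨hF, hs⟩ := N.isSimulation_simulates _ _ _ (hV hf).1
  refine ⟨hF, fun a ha => ?_⟩
  obtain ⟨p', hp', h1, h2⟩ := hs a ha
  refine ⟨p', hp', fun q' hq' => ?_, fun p'' hp'' => ?_⟩
  · obtain ⟨e', he', hle⟩ := h1 q' hq'
    refine ⟨_, ⟨⟨e', he'⟩, rfl⟩, ?_⟩
    rw [add_sub_assoc] at hle ⊢
    have := (hV he').2
    exact coveredBelow_le_add (hS _ _) (hm _ _ _ _ _ hp' hq') (by omega)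
  · obtain ⟨e', he'⟩ := h2 p'' hp''
    exact ⟨_, ⟨e', he'⟩, rfl⟩

end Simulation

end WAut

/-! ### Paths and energy levels -/

namespace EnergyGame

variable {V : Type*}

theorem lastVertex_append (v : V) (φ ψ : List (Bool × V)) :
    lastVertex v (φ ++ ψ) = lastVertex (lastVertex v φ) ψ := by
  induction φ generalizing v with
  | nil => rfl
  | cons s φ ih => exact ih s.2

theorem energyFrom_append (G : EnergyGame V) (c e : ℤ) (v : V) (φ ψ : List (Bool × V)) :
    G.energyFrom c v e (φ ++ ψ) = G.energyFrom c (lastVertex v φ) (G.energyFrom c v e φ) ψ := by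
  induction φ generalizing v e with
  | nil => rfl
  | cons s φ ih => exact ih _ s.2

theorem lastVertex_concat (v : V) (φ : List (Bool × V)) (b : Bool) (u : V) :
    lastVertex v (φ ++ [(b, u)]) = u := by
  simp [lastVertex_append, lastVertex]

theorem energyLevel_concat (G : EnergyGame V) (c : ℕ) (v : V) (φ : List (Bool × V)) (b : Bool)
    (u : V) : G.energyLevel c v (φ ++ [(b, u)]) =
      (if b then (c : ℤ) else G.energyLevel c v φ) + G.μ (lastVertex v φ, b, u) := by
  simp only [energyLevel, energyFrom_append]
  rfl

theorem natAbs_le_μMax [Fintype V] (G : EnergyGame V) {e : V × Bool × V} (he : e ∈ G.E) :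
    (G.μ e).natAbs ≤ G.μMax := by
  classical
  unfold μMax
  exact Finset.le_sup (f := fun e => (G.μ e).natAbs) (by simpa using he)

end EnergyGame

namespace WAut

open JokerVertex EnergyGame

variable {A : Type*} {Q : Type*}

/-! ### Winning the Joker game versus simulation -/

section Game

theorem conf_notMem_eve (N : WAut A Q) (p q : Q) : conf p q ∉ N.jokerGame.eve := by
  simp [jokerGame]

theorem resp_notMem_eve (N : WAut A Q) (p q p' : Q) (a : A) :
    resp p q p' a ∉ N.jokerGame.eve := by
  simp [jokerGame]

theorem symb_mem_eve (N : WAut A Q) (p q : Q) (a : A) : symb p q a ∈ N.jokerGame.eve :=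
  .inr ⟨p, q, a, rfl⟩

theorem bot_mem_eve (N : WAut A Q) : bot ∈ N.jokerGame.eve := .inl rfl

/-- The configurations and ⊥ alone are this many vertices. The extra 1 leaves room in the credit for
the weight of a reset edge. -/
theorem card_sq_add_one_le [Fintype A] [Fintype Q] :
    Fintype.card Q ^ 2 + 1 ≤ Fintype.card (JokerVertex A Q) := by
  rw [Fintype.card_congr (equivSum A Q)]
  simp only [Fintype.card_sum, Fintype.card_prod, Fintype.card_unit, sq]
  omega

theorem neg_μMax_le [Fintype A] [Fintype Q] (N : WAut A Q) (p q : Q) (a : A) (p' q' : Q)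
    (hp : (p, a, p') ∈ N.Δ) (hq : (q, a, q') ∈ N.Δ) :
    -(N.jokerGame.μMax : ℤ) ≤ N.w (p, a, p') - N.w (q, a, q') := by
  have h := N.jokerGame.natAbs_le_μMax (e := (resp p q p' a, false, conf p' q'))
    (JokerEdge.follow p q p' a q' hp hq)
  change (N.w (p, a, p') - N.w (q, a, q')).natAbs ≤ _ at h
  omega

theorem μMax_le [Fintype A] [Fintype Q] (N : WAut A Q) :
    N.jokerGame.μMax ≤ 2 * N.wMax + 1 := by
  classical
  unfold μMax
  refine Finset.sup_le ?_
  rintro ⟨u, b, v⟩ h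
  have h : N.JokerEdge u b v := (Finset.mem_filter.1 h).2
  cases h with
  | follow p q p' a q' hp hq =>
    have h1 := N.natAbs_le_wMax hp
    have h2 := N.natAbs_le_wMax hq
    simp only [jokerGame, jokerWeight]
    omega
  | joker p q p' a p'' hp hq =>
    have h1 := N.natAbs_le_wMax hp
    have h2 := N.natAbs_le_wMax hq
    simp only [jokerGame, jokerWeight]
    omega
  -- The loop at ⊥, of weight -1, is the reason for the summand 1.
  | _ => simp [jokerGame, jokerWeight]

/-- A consistent path of a winning strategy does not end in `⊥`. -/
theorem lastVertex_ne_bot {N : WAut A Q} {σ : List (Bool × JokerVertex A Q) → JokerVertex A Q}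
    {v : JokerVertex A Q} {c : ℕ}
    (hσ : ∀ φ, N.jokerGame.Consistent σ v φ →
      (lastVertex v φ ∈ N.jokerGame.eve → (lastVertex v φ, false, σ φ) ∈ N.jokerGame.E) ∧
        0 ≤ N.jokerGame.energyLevel c v φ)
    {φ : List (Bool × JokerVertex A Q)} (hφ : N.jokerGame.Consistent σ v φ) :
    lastVertex v φ ≠ bot := by
  intro hbot
  -- From ⊥ only the loop is available, and each turn of it costs 1.
  have key : ∀ k : ℕ, ∃ ψ, N.jokerGame.Consistent σ v ψ ∧ lastVertex v ψ = bot ∧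
      N.jokerGame.energyLevel c v ψ ≤ N.jokerGame.energyLevel c v φ - k := by
    intro k
    induction k with
    | zero => exact ⟨φ, hφ, hbot, by simp⟩
    | succ k ih =>
      obtain ⟨ψ, h1, h2, h3⟩ := ih
      have hm : lastVertex v ψ ∈ N.jokerGame.eve := h2 ▸ N.bot_mem_eve
      have hE := (hσ ψ h1).1 hm
      have hb : σ ψ = bot := by
        have hE' : N.JokerEdge (lastVertex v ψ) false (σ ψ) := hE
        rw [h2] at hE'
        generalize σ ψ = x at hE'
        cases hE'
        rfl
      refine ⟨_, .eve ψ h1 hm hE, by rw [lastVertex_concat, hb], ?_⟩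
      rw [energyLevel_concat, h2]
      have hμ : N.jokerGame.μ (bot, false, σ ψ) = -1 := rfl
      rw [hμ]
      simp only [Bool.false_eq_true, if_false]
      push_cast
      linarith
  obtain ⟨ψ, h1, -, h3⟩ := key (N.jokerGame.energyLevel c v φ + 1).toNat
  have h4 := (hσ ψ h1).2
  have h5 := (hσ φ hφ).2
  omega

/-- The configurations and energy levels at the ends of consistent paths form a simulation.
Quantifying over the paths absorbs the dependence of the strategy on the history. -/
theorem exists_simulates_of_eveWinsFrom {N : WAut A Q} {p q : Q} {c : ℕ}
    (h : N.jokerGame.EveWinsFrom (conf p q) c) : ∃ e, N.Simulates p q e := by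
  obtain ⟨σ, hσ⟩ := h
  refine ⟨c, fun p₁ q₁ e => ∃ φ, N.jokerGame.Consistent σ (conf p q) φ ∧
    lastVertex (conf p q) φ = conf p₁ q₁ ∧ N.jokerGame.energyLevel c (conf p q) φ = e, ?_,
    [], .nil, rfl, rfl⟩
  rintro p₁ q₁ e ⟨φ, hφ, hl, he⟩
  have toBot : ¬ N.JokerEdge (conf p₁ q₁) false bot := by
    intro hE
    refine lastVertex_ne_bot hσ (.adam φ false bot hφ ?_ ?_) (lastVertex_concat _ _ _ _)
    · rw [hl]
      exact N.conf_notMem_eve _ _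
    · rw [hl]
      exact hE
  refine ⟨fun hq => by_contra fun hp => toBot (.notFinal _ _ hp hq), ?_⟩
  rintro a ⟨q₀, hq₀⟩
  have c1 : N.jokerGame.Consistent σ (conf p q) (φ ++ [(false, symb p₁ q₁ a)]) := by
    refine .adam φ _ _ hφ ?_ ?_
    · rw [hl]
      exact N.conf_notMem_eve _ _
    · rw [hl]
      exact JokerEdge.symb _ _ _ _ hq₀
  set φ₁ := φ ++ [(false, symb p₁ q₁ a)] with hφ₁
  have l1 : lastVertex (conf p q) φ₁ = symb p₁ q₁ a := lastVertex_concat _ _ _ _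
  have m1 : lastVertex (conf p q) φ₁ ∈ N.jokerGame.eve := l1 ▸ N.symb_mem_eve _ _ _
  have e1 : N.jokerGame.energyLevel c (conf p q) φ₁ = e := by
    rw [hφ₁, energyLevel_concat, hl, he]
    simp [jokerGame, jokerWeight]
  have E1 := (hσ _ c1).1 m1
  obtain ⟨p', hp', hσ₁⟩ : ∃ p', (p₁, a, p') ∈ N.Δ ∧ σ φ₁ = resp p₁ q₁ p' a := by
    have E1' : N.JokerEdge (lastVertex (conf p q) φ₁) false (σ φ₁) := E1
    rw [l1] at E1'
    generalize σ φ₁ = x at E1'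
    cases E1' with
    | resp _ _ _ p' hp' => exact ⟨p', hp', rfl⟩
  have c2 := EnergyGame.Consistent.eve φ₁ c1 m1 E1
  rw [hσ₁] at c2
  set φ₂ := φ₁ ++ [(false, resp p₁ q₁ p' a)] with hφ₂
  have l2 : lastVertex (conf p q) φ₂ = resp p₁ q₁ p' a := lastVertex_concat _ _ _ _
  have e2 : N.jokerGame.energyLevel c (conf p q) φ₂ = e := by
    rw [hφ₂, energyLevel_concat, l1, e1]
    simp [jokerGame, jokerWeight]
  have m2 : lastVertex (conf p q) φ₂ ∉ N.jokerGame.eve := l2 ▸ N.resp_notMem_eve _ _ _ _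
  refine ⟨p', hp', fun q' hq' => ?_, fun p'' hp'' => ?_⟩
  · have c3 := EnergyGame.Consistent.adam (G := N.jokerGame) φ₂ false (conf p' q') c2 m2
      (by rw [l2]; exact JokerEdge.follow _ _ _ _ _ hp' hq')
    have h3 := (hσ _ c3).2
    refine ⟨_, ⟨_, c3, lastVertex_concat _ _ _ _, (Int.toNat_of_nonneg h3).symm⟩, ?_⟩
    rw [Int.toNat_of_nonneg h3, energyLevel_concat, l2, e2]
    simp [jokerGame, jokerWeight, add_sub_assoc]
  · have c3 := EnergyGame.Consistent.adam (G := N.jokerGame) φ₂ true (conf p' p'') c2 m2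
      (by rw [l2]; exact JokerEdge.joker _ _ _ _ _ hp' hp'')
    have h3 := (hσ _ c3).2
    exact ⟨_, ⟨_, c3, lastVertex_concat _ _ _ _, (Int.toNat_of_nonneg h3).symm⟩⟩

/-- Eve plays positionally, choosing a transition that is good for the least energy `V p q`, and
maintains an energy level of at least `V p q`. -/
theorem Simulates.eveWinsFrom [Fintype A] [Fintype Q] {N : WAut A Q} {p q : Q} {e : ℕ}
    (h : N.Simulates p q e) : N.jokerGame.EveWinsFrom (conf p q) N.jokerCredit := by
  classical
  set m := N.jokerGame.μMax with hm
  let V : Q → Q → ℕ := fun p q => sInf {e | N.Simulates p q e}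
  have hV : ∀ {p q e}, N.Simulates p q e → N.Simulates p q (V p q) ∧ V p q ≤ e := fun h =>
    ⟨Nat.sInf_mem (s := {e | N.Simulates _ _ e}) ⟨_, h⟩, Nat.sInf_le h⟩
  have hVle : ∀ {p q e}, N.Simulates p q e → V p q ≤ Fintype.card Q ^ 2 * m := fun h => by
    obtain ⟨e', he', h'⟩ := N.exists_rank m N.neg_μMax_le h
    exact (hV h').2.trans he'
  -- After a reset the weight of the reset edge is still charged; the spare `m` pays for it.
  have hcredit : Fintype.card Q ^ 2 * m + m ≤ N.jokerCredit := by
    have := Nat.mul_le_mul_right m (card_sq_add_one_le (A := A) (Q := Q))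
    rw [add_mul, one_mul] at this
    exact this
  have hstep : ∀ p q a, ∃ p', ∀ e, N.Simulates p q e → (∃ q', (q, a, q') ∈ N.Δ) →
      (p, a, p') ∈ N.Δ ∧
      (∀ q', (q, a, q') ∈ N.Δ → (∃ e, N.Simulates p' q' e) ∧
        (V p' q' : ℤ) ≤ V p q + N.w (p, a, p') - N.w (q, a, q')) ∧
      ∀ p'', (p, a, p'') ∈ N.Δ → ∃ e, N.Simulates p' p'' e := by
    intro p q a
    by_cases hc : (∃ e, N.Simulates p q e) ∧ ∃ q', (q, a, q') ∈ N.Δ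
    · obtain ⟨⟨e, he⟩, ha⟩ := hc
      obtain ⟨p', hp', h1, h2⟩ := (N.isSimulation_simulates _ _ _ (hV he).1).2 a ha
      refine ⟨p', fun _ _ _ => ⟨hp', fun q' hq' => ?_, h2⟩⟩
      obtain ⟨e', he', hle⟩ := h1 q' hq'
      have := (hV he').2
      exact ⟨⟨e', he'⟩, by omega⟩
    · exact ⟨p, fun e he ha => (hc ⟨⟨e, he⟩, ha⟩).elim⟩
  choose f hf using hstep
  -- Only the values at `symb` vertices matter: ⊥ is never reached and the other vertices are
  -- Adam's.
  let g : JokerVertex A Q → JokerVertex A Q := fun x => match x with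
    | symb p q a => resp p q (f p q a) a
    | x => x
  let Inv : JokerVertex A Q → ℤ → Prop := fun x E => match x with
    | conf p q => (∃ e, N.Simulates p q e) ∧ (V p q : ℤ) ≤ E
    | symb p q a => (∃ e, N.Simulates p q e) ∧ (V p q : ℤ) ≤ E ∧ ∃ q', (q, a, q') ∈ N.Δ
    | resp p q p' a => (∃ e, N.Simulates p q e) ∧ (V p q : ℤ) ≤ E ∧ (∃ q', (q, a, q') ∈ N.Δ) ∧
        p' = f p q a
    | bot => False
  have inv : ∀ φ, N.jokerGame.Consistent (fun φ => g (lastVertex (conf p q) φ)) (conf p q) φ →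
      Inv (lastVertex (conf p q) φ) (N.jokerGame.energyLevel N.jokerCredit (conf p q) φ) := by
    intro φ hφ
    induction hφ with
    | nil =>
      refine ⟨⟨e, h⟩, ?_⟩
      have := hVle h
      simp only [energyLevel, energyFrom]
      exact_mod_cast (this.trans (Nat.le_add_right _ _)).trans hcredit
    | eve φ hφ hm hE ih =>
      rw [lastVertex_concat, energyLevel_concat]
      generalize lastVertex (conf p q) φ = x at *
      generalize N.jokerGame.energyLevel N.jokerCredit (conf p q) φ = E at *
      cases x with
      | conf p q => exact (N.conf_notMem_eve _ _ hm).elim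
      | resp p q p' a => exact (N.resp_notMem_eve _ _ _ _ hm).elim
      | bot => exact ih.elim
      | symb p q a =>
        refine ⟨ih.1, ?_, ih.2.2, rfl⟩
        simpa [jokerGame, jokerWeight, g] using ih.2.1
    | adam φ b u hφ hm hE ih =>
      rw [lastVertex_concat, energyLevel_concat]
      generalize lastVertex (conf p q) φ = x at *
      generalize N.jokerGame.energyLevel N.jokerCredit (conf p q) φ = E at *
      have hE' : N.JokerEdge x b u := hE
      cases hE' with
      | symb p q a q' hq' =>
        refine ⟨ih.1, ?_, q', hq'⟩
        simpa [jokerGame, jokerWeight] using ih.2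
      | resp p q a p' hp' => exact (hm (N.symb_mem_eve _ _ _)).elim
      | follow p q p' a q' hp' hq' =>
        obtain ⟨⟨e, he⟩, hle, ha, rfl⟩ := ih
        obtain ⟨h1, h2⟩ := (hf p q a e he ha).2.1 q' hq'
        refine ⟨h1, ?_⟩
        simp only [jokerGame, jokerWeight, Bool.false_eq_true, if_false]
        linarith
      | joker p q p' a p'' hp' hp'' =>
        obtain ⟨⟨e, he⟩, hle, ha, rfl⟩ := ih
        obtain ⟨e', he'⟩ := (hf p q a e he ha).2.2 p'' hp''
        refine ⟨⟨e', he'⟩, ?_⟩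
        have h1 := hVle he'
        have h2 := N.neg_μMax_le _ _ _ _ _ hp' hp''
        simp only [jokerGame, jokerWeight, if_true]
        change _ ≤ (N.jokerCredit : ℤ) + _
        omega
      | notFinal p q hp hq =>
        obtain ⟨⟨e, he⟩, -⟩ := ih
        exact (hp ((N.isSimulation_simulates _ _ _ he).1 hq)).elim
      | stuck p q a q' hq' hp =>
        obtain ⟨⟨e, he⟩, -⟩ := ih
        obtain ⟨p', hp', -⟩ := (N.isSimulation_simulates _ _ _ he).2 a ⟨q', hq'⟩
        exact (hp p' hp').elim
      | loop => exact ih.elim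
  refine ⟨fun φ => g (lastVertex (conf p q) φ), fun φ hφ => ?_⟩
  have hi := inv φ hφ
  beta_reduce
  generalize N.jokerGame.energyLevel N.jokerCredit (conf p q) φ = E at *
  generalize lastVertex (conf p q) φ = x at *
  cases x with
  | conf p q => exact ⟨fun h => (N.conf_notMem_eve _ _ h).elim, (Nat.cast_nonneg _).trans hi.2⟩
  | resp p q p' a =>
    exact ⟨fun h => (N.resp_notMem_eve _ _ _ _ h).elim, (Nat.cast_nonneg _).trans hi.2.1⟩
  | bot => exact hi.elim
  | symb p q a =>
    obtain ⟨⟨e, he⟩, hle, ha⟩ := hi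
    exact ⟨fun _ => JokerEdge.resp _ _ _ _ (hf p q a e he ha).1, (Nat.cast_nonneg _).trans hle⟩

end Game

/-! ### Boundedness from simulation -/

section Boundedness

/-- The states reached from `S` by reading a word. -/
def post (N : WAut A Q) (S : Set Q) (α : List A) : Set Q :=
  {q | ∃ q₀ ∈ S, ∃ ρ, N.IsRun q₀ ρ ∧ word ρ = α ∧ lastState q₀ ρ = q}

theorem post_cons (N : WAut A Q) (S : Set Q) (a : A) (α : List A) :
    N.post S (a :: α) = N.post {q' | ∃ q ∈ S, (q, a, q') ∈ N.Δ} α := by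
  ext x
  constructor
  · rintro ⟨q, hq, ρ, hr, hw, hl⟩
    cases ρ with
    | nil => simp [word] at hw
    | cons s ρ =>
      obtain ⟨b, q'⟩ := s
      simp only [word, List.map_cons, List.cons.injEq] at hw
      obtain ⟨rfl, hw⟩ := hw
      exact ⟨q', ⟨q, hq, hr.1⟩, ρ, hr.2, hw, hl⟩
  · rintro ⟨q', ⟨q, hq, ht⟩, ρ, hr, rfl, hl⟩
    exact ⟨q, hq, (a, q') :: ρ, ⟨ht, hr⟩, rfl, hl⟩

/-- A state that simulates all states of `S` and simulates `q` with energy `e` can answer a run from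
`q` by a run to a state that again simulates all states that can then be reached from `S`. -/
theorem Simulates.exists_run {N : WAut A Q} {S : Set Q} {p q : Q} {e : ℕ}
    (hS : ∀ r ∈ S, ∃ f, N.Simulates p r f) (h : N.Simulates p q e) {ρ : List (A × Q)}
    (hρ : N.IsRun q ρ) :
    ∃ π, N.IsRun p π ∧ word π = word ρ ∧
      (∀ r ∈ N.post S (word ρ), ∃ f, N.Simulates (lastState p π) r f) ∧
      ∃ e', N.Simulates (lastState p π) (lastState q ρ) e' ∧
        (e' : ℤ) ≤ e + N.runWeight p π - N.runWeight q ρ := by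
  induction ρ generalizing S p q e with
  | nil =>
    refine ⟨[], trivial, rfl, ?_, e, h, by simp [runWeight]⟩
    rintro r ⟨q₀, hq₀, ρ, -, hw, rfl⟩
    obtain rfl : ρ = [] := by simpa [word] using hw
    exact hS _ hq₀
  | cons s ρ ih =>
    obtain ⟨a, q'⟩ := s
    obtain ⟨p', hp', h1, h2⟩ := (N.isSimulation_simulates _ _ _ h).2 a ⟨q', hρ.1⟩
    obtain ⟨e', he', hle⟩ := h1 q' hρ.1
    -- The move of `r` to `r'` is answered by some move of `p` to `p''`. A joker could put Adam at
    -- `p''`, so `p'` simulates `p''`, and by transitivity `r'`.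
    have hS' : ∀ r' ∈ {q' | ∃ q ∈ S, (q, a, q') ∈ N.Δ}, ∃ f, N.Simulates p' r' f := by
      rintro r' ⟨r, hr, hrr'⟩
      obtain ⟨f, hf⟩ := hS r hr
      obtain ⟨p'', hp'', k1, -⟩ := (N.isSimulation_simulates _ _ _ hf).2 a ⟨r', hrr'⟩
      obtain ⟨f', hf', -⟩ := k1 r' hrr'
      obtain ⟨g, hg⟩ := h2 p'' hp''
      exact ⟨_, hg.trans hf'⟩
    obtain ⟨π, r1, r2, r3, e'', r4, r5⟩ := ih hS' he' hρ.2
    refine ⟨(a, p') :: π, ⟨hp', r1⟩, ?_, ?_, e'', r4, ?_⟩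
    · simpa [word] using r2
    · change ∀ r ∈ N.post S (a :: word ρ), _
      rw [post_cons]
      exact r3
    · simp only [runWeight]
      linarith

/-- Eve first answers the competing run and then, from the state reached, the rest of the maximal
run. Each answer loses at most `M`, and the concatenation is an accepting run on the same word. -/
theorem isBounded_of_simulates [Finite Q] {N : WAut A Q} (hN : N.IsTrim) {M : ℕ}
    (hM : ∀ {p q e}, N.Simulates p q e → ∃ e' ≤ M, N.Simulates p q e') {p₀ : Q} (hp₀ : p₀ ∈ N.I)
    (h₀ : ∀ q ∈ N.I, ∃ e, N.Simulates p₀ q e) : N.IsBounded (2 * M) := by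
  refine ⟨hN, fun p ρ hacc hmax i _ q ρ' hq hρ' hw => ?_⟩
  have hsplit : ρ.take i ++ ρ.drop i = ρ := List.take_append_drop i ρ
  have hrun := hacc.2.1
  rw [← hsplit, isRun_append] at hrun
  obtain ⟨e, he⟩ := h₀ q hq
  obtain ⟨e₁, he₁, hs₁⟩ := hM he
  obtain ⟨π, r1, r2, r3, e₂, -, r5⟩ := hs₁.exists_run h₀ hρ'
  obtain ⟨f, hf⟩ := r3 (lastState p (ρ.take i)) ⟨p, hacc.1, _, hrun.1, hw.symm, rfl⟩
  obtain ⟨f₁, hf₁, hs₂⟩ := hM hf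
  obtain ⟨π', k1, k2, -, f₂, k4, k5⟩ := hs₂.exists_run r3 hrun.2
  rw [← lastState_append, ← lastState_append, hsplit] at k4
  have hacc' : N.IsAccepting p₀ (π ++ π') :=
    ⟨hp₀, (isRun_append _ _ _ _).2 ⟨r1, k1⟩, (N.isSimulation_simulates _ _ _ k4).1 hacc.2.2⟩
  have hword : word (π ++ π') = word ρ := by
    rw [word_append, r2, k2, hw, ← word_append, hsplit]
  have hle := N.runWeight_le_eval hacc'
  rw [hword, ← hmax, runWeight_append] at hle
  have hsum := N.runWeight_append p (ρ.take i) (ρ.drop i)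
  rw [hsplit] at hsum
  push_cast
  omega

theorem IsBounded.mono {N : WAut A Q} {B B' : ℕ} (h : N.IsBounded B) (hB : B ≤ B') :
    N.IsBounded B' :=
  ⟨h.1, fun p ρ h1 h2 i hi q ρ' h3 h4 h5 =>
    (h.2 p ρ h1 h2 i hi q ρ' h3 h4 h5).trans (by exact_mod_cast hB)⟩

/-- The factor is |Q|² and not the number of vertices, which grows with the alphabet; this keeps the
size bound polynomial in |Q| and `wMax` alone. -/
theorem EveWinsJoker.isBounded [Fintype A] [Fintype Q] {N : WAut A Q} (h : N.EveWinsJoker)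
    (hN : N.IsTrim) : N.IsBounded (2 * (Fintype.card Q ^ 2 * N.jokerGame.μMax)) := by
  obtain ⟨p₀, hp₀, hw⟩ := h
  exact isBounded_of_simulates hN (fun h => N.exists_rank _ N.neg_μMax_le h) hp₀
    fun q hq => exists_simulates_of_eveWinsFrom (hw q hq)

end Boundedness

end WAut

namespace WAut

variable {A : Type*} {Q : Type*} {Q' : Type*}

/-! ### Determinization of bounded automata -/

section Determinization

/-- The state and value of the deterministic automaton with transition function `step` and weights
`wt` after a word. -/
def trace {S : Type*} (step : S → A → S) (wt : S → A → ℤ) (s : S) (α : List A) : S × ℤ :=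
  α.foldl (fun t a => (step t.1 a, t.2 + wt t.1 a)) (s, 0)

theorem trace_concat {S : Type*} (step : S → A → S) (wt : S → A → ℤ) (s : S) (α : List A) (a : A) :
    trace step wt s (α ++ [a]) =
      (step (trace step wt s α).1 a, (trace step wt s α).2 + wt (trace step wt s α).1 a) := by
  simp [trace]

/-- The complete deterministic automaton with transition function `step` and weights `wt`. -/
def ofStep {S : Type*} (step : S → A → S) (wt : S → A → ℤ) (s₀ : S) (F : Set S) : WAut A S where
  I := {s₀}
  Δ := {t | t.2.2 = step t.1 t.2.1}
  w t := wt t.1 t.2.1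
  F := F

section ofStep

variable {S : Type*} (step : S → A → S) (wt : S → A → ℤ) (s₀ : S) (F : Set S)

theorem isDeterministic_ofStep : (ofStep step wt s₀ F).IsDeterministic :=
  ⟨⟨s₀, rfl⟩, fun _ _ _ _ h₁ h₂ => Eq.trans h₁ (Eq.symm h₂)⟩

theorem ofStep_run (ρ : List (A × S)) (h : (ofStep step wt s₀ F).IsRun s₀ ρ) :
    lastState s₀ ρ = (trace step wt s₀ (word ρ)).1 ∧
      (ofStep step wt s₀ F).runWeight s₀ ρ = (trace step wt s₀ (word ρ)).2 := by
  induction ρ using List.reverseRecOn with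
  | nil => exact ⟨rfl, rfl⟩
  | append_singleton ρ s ih =>
    obtain ⟨a, q⟩ := s
    rw [isRun_concat] at h
    obtain ⟨h1, h2⟩ := ih h.1
    have h3 : q = step (lastState s₀ ρ) a := h.2
    rw [word_append, runWeight_concat, lastState_concat, h3, h2, h1]
    change _ = (trace step wt s₀ (word ρ ++ [a])).1 ∧ _ = (trace step wt s₀ (word ρ ++ [a])).2
    rw [trace_concat]
    exact ⟨rfl, rfl⟩

theorem exists_ofStep_run (α : List A) :
    ∃ ρ, (ofStep step wt s₀ F).IsRun s₀ ρ ∧ word ρ = α := by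
  induction α using List.reverseRecOn with
  | nil => exact ⟨[], trivial, rfl⟩
  | append_singleton α a ih =>
    obtain ⟨ρ, h, rfl⟩ := ih
    refine ⟨ρ ++ [(a, step (lastState s₀ ρ) a)], (isRun_concat _ _ _ _ _).2 ⟨h, rfl⟩, ?_⟩
    rw [word_append]
    rfl

theorem values_ofStep (α : List A) (x : ℤ) : x ∈ (ofStep step wt s₀ F).values α ↔
    (trace step wt s₀ α).1 ∈ F ∧ (trace step wt s₀ α).2 = x := by
  constructor
  · rintro ⟨q, ρ, ⟨rfl, hr, hF⟩, rfl, rfl⟩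
    obtain ⟨h1, h2⟩ := ofStep_run step wt _ F ρ hr
    exact ⟨h1 ▸ hF, h2.symm⟩
  · rintro ⟨hF, rfl⟩
    obtain ⟨ρ, hr, rfl⟩ := exists_ofStep_run step wt s₀ F α
    obtain ⟨h1, h2⟩ := ofStep_run step wt _ F ρ hr
    exact ⟨s₀, ρ, ⟨rfl, hr, h1.symm ▸ hF⟩, rfl, h2⟩

theorem ncard_ofStep [Fintype A] [Fintype S] :
    (ofStep step wt s₀ F).Δ.ncard = Fintype.card A * Fintype.card S := by
  have : (ofStep step wt s₀ F).Δ =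
      (fun t : A × S => (t.2, t.1, step t.2 t.1)) '' Set.univ := by
    ext ⟨s, a, s'⟩
    constructor
    · intro h
      exact ⟨(a, s), trivial, by rw [show s' = step s a from h]⟩
    · rintro ⟨t, -, ht⟩
      obtain ⟨rfl, rfl, rfl⟩ := by simpa using ht
      rfl
  rw [this, Set.ncard_image_of_injective, Set.ncard_univ, Nat.card_eq_fintype_card,
    Fintype.card_prod]
  rintro ⟨a, s⟩ ⟨b, t⟩ h
  simp only [Prod.mk.injEq] at h
  rw [h.1, h.2.1]

end ofStep

open Classical in
/-- The values of the empty runs. -/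
noncomputable def initValue (N : WAut A Q) (q : Q) : WithBot ℤ := if q ∈ N.I then (0 : ℤ) else ⊥

theorem initValue_eq_coe {N : WAut A Q} {q : Q} {x : ℤ} :
    N.initValue q = x ↔ q ∈ N.I ∧ x = 0 := by
  unfold initValue
  split_ifs with h
  · rw [WithBot.coe_inj]
    simp [h, eq_comm]
  · simp [h]

/-- Invariant of the determinization of a `B`-bounded automaton, for the value function `K` reached,
with value `c`, after the word `α`. -/
structure IsTracking (N : WAut A Q) (α : List A) (K : Q → WithBot ℤ) (c : ℤ) : Prop where
  sound : ∀ q (x : ℤ), K q = x →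
    ∃ q₀ ∈ N.I, ∃ ρ, N.IsRun q₀ ρ ∧ word ρ = α ∧ lastState q₀ ρ = q ∧ N.runWeight q₀ ρ = x + c
  complete : ∀ q₀ ρ₁ ρ₂, N.IsAccepting q₀ (ρ₁ ++ ρ₂) →
    N.runWeight q₀ (ρ₁ ++ ρ₂) = N.eval (word (ρ₁ ++ ρ₂)) → word ρ₁ = α →
    ∃ x : ℤ, K (lastState q₀ ρ₁) = x ∧ N.runWeight q₀ ρ₁ ≤ x + c
  final_le : ∀ q ∈ N.F, ∀ x : ℤ, K q = x → x ≤ 0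
  final_eq : (∃ q ∈ N.F, K q ≠ ⊥) → ∃ q ∈ N.F, K q = (0 : ℤ)

theorem isTracking_init (N : WAut A Q) : N.IsTracking [] N.initValue 0 where
  sound q x hx := by
    obtain ⟨hq, rfl⟩ := initValue_eq_coe.1 hx
    exact ⟨q, hq, [], trivial, rfl, rfl, rfl⟩
  complete q₀ ρ₁ ρ₂ h _ hw := by
    obtain rfl : ρ₁ = [] := by simpa [word] using hw
    exact ⟨0, initValue_eq_coe.2 ⟨h.1, rfl⟩, le_rfl⟩
  final_le q _ x hx := (initValue_eq_coe.1 hx).2.le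
  final_eq := by
    rintro ⟨q, hq, hK⟩
    refine ⟨q, hq, initValue_eq_coe.2 ⟨?_, rfl⟩⟩
    by_contra h
    exact hK (by simp [initValue, h])

variable [Fintype Q]

open Classical in
/-- The maximal values of the runs that extend by `a` runs with values `K`. -/
noncomputable def stepValue (N : WAut A Q) (K : Q → WithBot ℤ) (a : A) (q' : Q) : WithBot ℤ :=
  Finset.univ.sup fun q => if (q, a, q') ∈ N.Δ then K q + (N.w (q, a, q') : WithBot ℤ) else ⊥

open Classical in
/-- Forget the values that are by more than `B` below the maximal one. -/
noncomputable def truncValue (B : ℕ) (K : Q → WithBot ℤ) (q : Q) : WithBot ℤ :=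
  if Finset.univ.sup K ≤ K q + ((B : ℤ) : WithBot ℤ) then K q else ⊥

open Classical in
/-- The maximal value at a final state if there is one, and the maximal value otherwise. -/
noncomputable def refValue (N : WAut A Q) (K : Q → WithBot ℤ) : ℤ :=
  if ∃ q ∈ N.F, K q ≠ ⊥ then ((Finset.univ.filter (· ∈ N.F)).sup K).unbotD 0
  else (Finset.univ.sup K).unbotD 0

/-- The values relative to `refValue`. -/
noncomputable def normValue (N : WAut A Q) (K : Q → WithBot ℤ) (q : Q) : WithBot ℤ :=
  (K q).map (· - N.refValue K)

theorem stepValue_eq_coe {N : WAut A Q} {K : Q → WithBot ℤ} {a : A} {q' : Q} {y : ℤ}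
    (h : N.stepValue K a q' = y) :
    ∃ q x, (q, a, q') ∈ N.Δ ∧ K q = (x : ℤ) ∧ y = x + N.w (q, a, q') := by
  classical
  have hne : (Finset.univ : Finset Q).Nonempty := ⟨q', Finset.mem_univ _⟩
  obtain ⟨q, -, hq⟩ := Finset.exists_mem_eq_sup _ hne fun q =>
    if (q, a, q') ∈ N.Δ then K q + (N.w (q, a, q') : WithBot ℤ) else ⊥
  have hq' : (if (q, a, q') ∈ N.Δ then K q + (N.w (q, a, q') : WithBot ℤ) else ⊥) = (y : ℤ) := by
    rw [← hq, ← h]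
    rfl
  split_ifs at hq' with ht
  · cases hK : K q with
    | bot => simp [hK] at hq'
    | coe x =>
      rw [hK, ← WithBot.coe_add, WithBot.coe_inj] at hq'
      exact ⟨q, x, ht, hK, hq'.symm⟩
  · simp at hq'

theorem le_stepValue {N : WAut A Q} {K : Q → WithBot ℤ} {a : A} {q q' : Q} {x : ℤ}
    (ht : (q, a, q') ∈ N.Δ) (h : K q = x) :
    ∃ y : ℤ, N.stepValue K a q' = y ∧ x + N.w (q, a, q') ≤ y := by
  classical
  have hle : ((x + N.w (q, a, q') : ℤ) : WithBot ℤ) ≤ N.stepValue K a q' := by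
    have := Finset.le_sup (s := Finset.univ) (f := fun q =>
      if (q, a, q') ∈ N.Δ then K q + (N.w (q, a, q') : WithBot ℤ) else ⊥) (Finset.mem_univ q)
    simpa [ht, h, stepValue] using this
  cases hK : N.stepValue K a q' with
  | bot => simp [hK] at hle
  | coe y => exact ⟨y, rfl, by rw [hK] at hle; exact WithBot.coe_le_coe.1 hle⟩

theorem truncValue_eq_coe {B : ℕ} {K : Q → WithBot ℤ} {q : Q} {y : ℤ} :
    truncValue B K q = y ↔ K q = y ∧ ∀ q' x, K q' = (x : ℤ) → x ≤ y + B := by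
  classical
  unfold truncValue
  have hiff : ∀ y : ℤ, (Finset.univ.sup K ≤ (y : WithBot ℤ) + ((B : ℤ) : WithBot ℤ)) ↔
      ∀ q' x, K q' = (x : ℤ) → x ≤ y + B := by
    intro y
    rw [← WithBot.coe_add, Finset.sup_le_iff]
    constructor
    · intro h q' x hx
      have := h q' (Finset.mem_univ _)
      rw [hx] at this
      exact WithBot.coe_le_coe.1 this
    · intro h q' _
      cases hx : K q' with
      | bot => exact bot_le
      | coe x => exact WithBot.coe_le_coe.2 (h q' x hx)
  constructor
  · intro h
    split_ifs at h with hc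
    · rw [h, hiff] at hc
      exact ⟨h, hc⟩
    · simp at h
  · rintro ⟨h, hc⟩
    rw [if_pos, h]
    rw [h, hiff]
    exact hc

theorem normValue_eq_coe {N : WAut A Q} {K : Q → WithBot ℤ} {q : Q} {y : ℤ} :
    N.normValue K q = y ↔ K q = ((y + N.refValue K : ℤ) : WithBot ℤ) := by
  unfold normValue
  cases h : K q with
  | bot => exact iff_of_false (by simp) WithBot.bot_ne_coe
  | coe x =>
    rw [WithBot.map_coe, WithBot.coe_inj, WithBot.coe_inj]
    omega

theorem refValue_final {N : WAut A Q} {K : Q → WithBot ℤ} (h : ∃ q ∈ N.F, K q ≠ ⊥) :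
    (∃ q ∈ N.F, K q = N.refValue K) ∧ ∀ q ∈ N.F, ∀ x : ℤ, K q = x → x ≤ N.refValue K := by
  classical
  obtain ⟨q₀, hq₀, hK₀⟩ := h
  have hmem : ∀ {q}, q ∈ N.F → q ∈ Finset.univ.filter (· ∈ N.F) := fun h => by simpa using h
  obtain ⟨q₁, hq₁, hs⟩ := Finset.exists_mem_eq_sup _ ⟨q₀, hmem hq₀⟩ K
  have hle : ∀ q ∈ N.F, K q ≤ K q₁ := fun q hq => hs ▸ Finset.le_sup (hmem hq)
  rw [refValue, if_pos ⟨q₀, hq₀, hK₀⟩, hs]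
  cases hK : K q₁ with
  | bot => exact (hK₀ (le_bot_iff.1 (hK ▸ hle q₀ hq₀))).elim
  | coe y =>
    rw [WithBot.unbotD_coe]
    refine ⟨⟨q₁, (Finset.mem_filter.1 hq₁).2, hK⟩, fun q hq x hx => ?_⟩
    have := hle q hq
    rw [hx, hK] at this
    exact WithBot.coe_le_coe.1 this

theorem refValue_mem (N : WAut A Q) {K : Q → WithBot ℤ} (h : ∃ q, K q ≠ ⊥) :
    ∃ q, K q = N.refValue K := by
  classical
  by_cases hF : ∃ q ∈ N.F, K q ≠ ⊥
  · obtain ⟨⟨q, -, hq⟩, -⟩ := refValue_final hF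
    exact ⟨q, hq⟩
  · obtain ⟨q₀, hK₀⟩ := h
    obtain ⟨q₁, -, hs⟩ := Finset.exists_mem_eq_sup Finset.univ ⟨q₀, Finset.mem_univ _⟩ K
    refine ⟨q₁, ?_⟩
    rw [refValue, if_neg hF, hs]
    cases hK : K q₁ with
    | bot =>
      have : K q₀ ≤ K q₁ := hs ▸ Finset.le_sup (Finset.mem_univ _)
      exact (hK₀ (le_bot_iff.1 (hK ▸ this))).elim
    | coe y => rfl

/-- When no value survives, the default makes the transition weight 0, within the bound on the
weights. -/
theorem refValue_of_bot (N : WAut A Q) {K : Q → WithBot ℤ} (h : ¬ ∃ q, K q ≠ ⊥) :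
    N.refValue K = 0 := by
  push Not at h
  have hK : K = fun _ => ⊥ := funext h
  subst hK
  simp [refValue]

/-- The normalised value functions: the values are `⊥` or between `-B` and `B`. -/
noncomputable def window (Q : Type*) [Fintype Q] (B : ℕ) : Finset (Q → WithBot ℤ) :=
  open Classical in
  Fintype.piFinset fun _ => insert ⊥ ((Finset.Icc (-(B : ℤ)) B).image fun x : ℤ => (x : WithBot ℤ))

theorem mem_window {B : ℕ} {K : Q → WithBot ℤ} :
    K ∈ window Q B ↔ ∀ q (x : ℤ), K q = x → -(B : ℤ) ≤ x ∧ x ≤ B := by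
  classical
  simp only [window, Fintype.mem_piFinset, Finset.mem_insert, Finset.mem_image, Finset.mem_Icc]
  refine forall_congr' fun q => ?_
  cases K q with
  | bot => simp
  | coe y => simp

theorem card_window_le (B : ℕ) : (window Q B).card ≤ (2 * B + 2) ^ Fintype.card Q := by
  classical
  rw [window, Fintype.card_piFinset, Finset.prod_const, Finset.card_univ]
  refine Nat.pow_le_pow_left ?_ _
  refine (Finset.card_insert_le _ _).trans ?_
  have := Finset.card_image_le (s := Finset.Icc (-(B : ℤ)) B) (f := fun x : ℤ => (x : WithBot ℤ))
  rw [Int.card_Icc] at this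
  omega

/-- The reference value is itself one of the surviving values, and any two of these differ by at
most `B`. -/
theorem normValue_truncValue_mem_window (N : WAut A Q) (B : ℕ) (K : Q → WithBot ℤ) :
    N.normValue (truncValue B K) ∈ window Q B := by
  rw [mem_window]
  intro q x hx
  rw [normValue_eq_coe] at hx
  obtain ⟨q', hq'⟩ := N.refValue_mem (K := truncValue B K) ⟨q, by simp [hx]⟩
  generalize N.refValue (truncValue B K) = z at *
  rw [truncValue_eq_coe] at hx hq'
  have h1 := hx.2 _ _ hq'.1
  have h2 := hq'.2 _ _ hx.1
  omega

theorem initValue_mem_window (N : WAut A Q) (B : ℕ) : N.initValue ∈ window Q B := by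
  rw [mem_window]
  intro q x hx
  obtain ⟨-, rfl⟩ := initValue_eq_coe.1 hx
  omega

/-- Every stored value belongs to an actual initial run, so boundedness puts a prefix of a maximal
accepting run at most `B` below all of them: truncation never discards it. -/
theorem IsTracking.step {N : WAut A Q} {B : ℕ} (hB : N.IsBounded B) {α : List A}
    {K : Q → WithBot ℤ} {c : ℤ} (h : N.IsTracking α K c) (a : A) :
    N.IsTracking (α ++ [a]) (N.normValue (truncValue B (N.stepValue K a)))
      (c + N.refValue (truncValue B (N.stepValue K a))) := by
  have sound : ∀ q (x : ℤ), N.stepValue K a q = x → ∃ q₀ ∈ N.I, ∃ ρ, N.IsRun q₀ ρ ∧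
      word ρ = α ++ [a] ∧ lastState q₀ ρ = q ∧ N.runWeight q₀ ρ = x + c := by
    intro q' y hy
    obtain ⟨q, x, ht, hx, rfl⟩ := stepValue_eq_coe hy
    obtain ⟨q₀, hq₀, ρ, hr, rfl, rfl, hw⟩ := h.sound q x hx
    refine ⟨q₀, hq₀, ρ ++ [(a, q')], (isRun_concat _ _ _ _ _).2 ⟨hr, ht⟩, word_append _ _,
      lastState_concat _ _ _ _, ?_⟩
    rw [runWeight_concat, hw]
    ring
  have hbot : ∀ {q}, N.normValue (truncValue B (N.stepValue K a)) q ≠ ⊥ →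
      truncValue B (N.stepValue K a) q ≠ ⊥ := by
    intro q hq h0
    exact hq (by simp [normValue, h0])
  refine ⟨fun q x hx => ?_, fun q₀ ρ₁ ρ₂ hacc hmax hw => ?_, fun q hq x hx => ?_, ?_⟩
  · rw [normValue_eq_coe, truncValue_eq_coe] at hx
    obtain ⟨q₀, hq₀, ρ, hr, h1, h2, h3⟩ := sound _ _ hx.1
    exact ⟨q₀, hq₀, ρ, hr, h1, h2, by rw [h3]; ring⟩
  · rcases List.eq_nil_or_concat ρ₁ with rfl | ⟨ρ, ⟨b, q'⟩, rfl⟩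
    · simp [word] at hw
    rw [List.concat_eq_append] at *
    have hw' : word ρ = α ∧ b = a := by
      rw [word_append] at hw
      simpa [word] using List.append_inj' hw rfl
    obtain ⟨rfl, rfl⟩ := hw'
    have hrun := ((isRun_append _ _ _ _).1 hacc.2.1).1
    obtain ⟨x, hx, hle⟩ := h.complete q₀ ρ ((b, q') :: ρ₂) (by simpa using hacc)
      (by simpa using hmax) rfl
    obtain ⟨y, hy, hxy⟩ := le_stepValue ((isRun_concat _ _ _ _ _).1 hrun).2 hx
    have hle' : N.runWeight q₀ (ρ ++ [(b, q')]) ≤ y + c := by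
      rw [runWeight_concat]
      linarith
    refine ⟨y - N.refValue (truncValue B (N.stepValue K b)), ?_, by linarith⟩
    rw [lastState_concat, normValue_eq_coe, sub_add_cancel, truncValue_eq_coe]
    refine ⟨hy, fun q x hx => ?_⟩
    obtain ⟨q₁, hq₁, π, k1, k2, -, k4⟩ := sound q x hx
    have := hB.2 q₀ _ hacc hmax (ρ ++ [(b, q')]).length (by simp) q₁ π hq₁ k1
      (by rw [List.take_left, k2, word_append]; rfl)
    rw [List.take_left] at this
    linarith
  · have := (refValue_final ⟨q, hq, hbot (by simp [hx])⟩).2 q hq _ (normValue_eq_coe.1 hx)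
    linarith
  · rintro ⟨q, hq, hK⟩
    obtain ⟨⟨q₁, hq₁, h1⟩, -⟩ := refValue_final ⟨q, hq, hbot hK⟩
    exact ⟨q₁, hq₁, normValue_eq_coe.2 (by rw [h1, zero_add])⟩

/-- There are no final weights, so `c` itself has to be the value of an accepted word. This is why
the best value at a final state is normalised to 0. -/
theorem IsTracking.values {N : WAut A Q} {α : List A} {K : Q → WithBot ℤ} {c : ℤ}
    (h : N.IsTracking α K c) :
    (α ∈ N.language ↔ ∃ q ∈ N.F, K q ≠ ⊥) ∧ (α ∈ N.language → N.eval α = c) := by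
  have h1 : (∃ q ∈ N.F, K q ≠ ⊥) → ∃ q ρ, N.IsAccepting q ρ ∧ word ρ = α ∧
      N.runWeight q ρ = c := by
    intro hF
    obtain ⟨q, hq, hK⟩ := h.final_eq hF
    obtain ⟨q₀, hq₀, ρ, hr, hw, rfl, hx⟩ := h.sound q 0 hK
    exact ⟨q₀, ρ, ⟨hq₀, hr, hq⟩, hw, by rw [hx, zero_add]⟩
  have h2 : α ∈ N.language → (∃ q ∈ N.F, K q ≠ ⊥) ∧ N.eval α ≤ c := by
    intro hα
    obtain ⟨q, ρ, hacc, rfl, hx⟩ := N.exists_runWeight_eq_eval hα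
    obtain ⟨x, hK, hle⟩ := h.complete q ρ [] (by simpa using hacc) (by simpa using hx) rfl
    have := h.final_le _ hacc.2.2 x hK
    exact ⟨⟨_, hacc.2.2, by simp [hK]⟩, by linarith⟩
  refine ⟨⟨fun hα => (h2 hα).1, fun hF => ?_⟩, fun hα => ?_⟩
  · obtain ⟨q, ρ, hacc, hw, -⟩ := h1 hF
    exact ⟨q, ρ, hacc, hw⟩
  · obtain ⟨hF, hle⟩ := h2 hα
    obtain ⟨q, ρ, hacc, rfl, hx⟩ := h1 hF
    exact le_antisymm hle (hx ▸ N.runWeight_le_eval hacc)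

/-- A `B`-bounded automaton is equivalent to a deterministic one that keeps track of the maximal
values of the runs to each state, as long as they are at most `B` below the best one. -/
theorem IsBounded.exists_deterministic [Fintype A] {N : WAut A Q} {B : ℕ} (hB : N.IsBounded B) :
    ∃ (Q' : Type) (_ : Fintype Q') (D : WAut A Q'), D.IsDeterministic ∧ N.Equivalent D ∧
      Fintype.card Q' ≤ (2 * B + 2) ^ Fintype.card Q ∧
      D.Δ.ncard ≤ Fintype.card A * (2 * B + 2) ^ Fintype.card Q ∧ D.wMax ≤ B + N.wMax := by
  classical
  let W := {K // K ∈ window Q B}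
  -- Transport to `Fin` puts the states into `Type`, whatever the universe of `Q`.
  let ε : W ≃ Fin (window Q B).card := (window Q B).equivFin
  let step : Fin (window Q B).card → A → Fin (window Q B).card := fun i a =>
    ε ⟨_, N.normValue_truncValue_mem_window B (N.stepValue (ε.symm i).1 a)⟩
  let wt : Fin (window Q B).card → A → ℤ := fun i a =>
    N.refValue (truncValue B (N.stepValue (ε.symm i).1 a))
  let s₀ := ε ⟨_, N.initValue_mem_window B⟩
  let F : Set (Fin (window Q B).card) := {i | ∃ q ∈ N.F, (ε.symm i).1 q ≠ ⊥}
  have key : ∀ α, N.IsTracking α (ε.symm (trace step wt s₀ α).1).1 (trace step wt s₀ α).2 := by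
    intro α
    induction α using List.reverseRecOn with
    | nil => simpa [trace, s₀] using N.isTracking_init
    | append_singleton α a ih =>
      have := ih.step hB a
      rw [trace_concat]
      simpa only [step, wt, Equiv.symm_apply_apply] using this
  have hmem : ∀ α, α ∈ (ofStep step wt s₀ F).language ↔ (trace step wt s₀ α).1 ∈ F := fun α => by
    rw [mem_language_iff]
    exact ⟨fun ⟨x, hx⟩ => ((values_ofStep ..).1 hx).1,
      fun h => ⟨_, (values_ofStep ..).2 ⟨h, rfl⟩⟩⟩
  have hlang : N.language = (ofStep step wt s₀ F).language := by
    ext α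
    rw [(key α).values.1, hmem]
    rfl
  have hcard := card_window_le (Q := Q) B
  refine ⟨_, inferInstance, ofStep step wt s₀ F, isDeterministic_ofStep _ _ _ _,
    ⟨hlang, fun α hα => ?_⟩, ?_, ?_, ?_⟩
  · rw [(key α).values.2 hα]
    have hv := (isGreatest_eval _ (hlang ▸ hα)).1
    exact ((values_ofStep ..).1 hv).2
  · simpa using hcard
  · rw [ncard_ofStep]
    exact Nat.mul_le_mul_left _ (by simpa using hcard)
  · unfold wMax
    refine Finset.sup_le ?_
    rintro ⟨i, a, j⟩ -
    change (N.refValue (truncValue B (N.stepValue (ε.symm i).1 a))).natAbs ≤ B + N.wMax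
    -- A reference value that is attained is a stored value, between `-B` and `B`, plus one
    -- transition weight.
    by_cases h : ∃ q, truncValue B (N.stepValue (ε.symm i).1 a) q ≠ ⊥
    · obtain ⟨q, hq⟩ := N.refValue_mem h
      obtain ⟨p, x, ht, hx, hy⟩ := stepValue_eq_coe (truncValue_eq_coe.1 hq).1
      have h1 := mem_window.1 (ε.symm i).2 p x hx
      have h2 := N.natAbs_le_wMax ht
      omega
    · rw [N.refValue_of_bot h]
      simp

end Determinization

end WAut

namespace WAut

variable {A : Type*} {Q : Type*} {Q' : Type*}

/-! ### From bounded regret to a winning strategy -/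

section Regret

/-- Eve follows the run of `D` through the homomorphism. Her energy is `C` plus the lead of this run
over Adam's, and never becomes negative because Adam's run could be completed to an accepting one.
-/
theorem IsRegretDeterminizable.eveWinsJoker [Fintype A] [Fintype Q] {N : WAut A Q}
    (hN : N.IsTrim) {r : ℕ} (h : N.IsRegretDeterminizable r) : N.EveWinsJoker := by
  obtain ⟨Q', _, D, hD, ⟨h, hh⟩, hlang, hreg⟩ := h
  obtain ⟨d₀, hd₀⟩ := hD.1
  have hd₀I : d₀ ∈ D.I := hd₀ ▸ rfl
  choose κ hκ using fun q => (hN q).2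
  set L : ℕ := Finset.univ.sup fun q => (κ q).length with hL
  -- Regret `r` on the completed word, plus the weights of the completions, of length at most `L`,
  -- on both sides.
  set C : ℕ := r + 2 * (L * N.wMax) with hC
  -- a run of `D` can be extended like the runs of `N` on the same word
  have ext : ∀ π, D.IsRun d₀ π → ∀ q₀ ∈ N.I, ∀ ρ, N.IsRun q₀ ρ → word π = word ρ →
      ∀ ρ', N.IsRun (lastState q₀ ρ) ρ' → lastState (lastState q₀ ρ) ρ' ∈ N.F →
      ∃ π', D.IsRun (lastState d₀ π) π' ∧ word π' = word ρ' ∧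
        D.IsAccepting d₀ (π ++ π') ∧
        N.runWeight q₀ (ρ ++ ρ') ≤ D.runWeight d₀ (π ++ π') + r := by
    intro π hπ q₀ hq₀ ρ hρ hw ρ' hρ' hF
    have hacc : N.IsAccepting q₀ (ρ ++ ρ') :=
      ⟨hq₀, (isRun_append _ _ _ _).2 ⟨hρ, hρ'⟩, by rwa [lastState_append]⟩
    have hα : word (ρ ++ ρ') ∈ N.language := ⟨q₀, _, hacc, rfl⟩
    obtain ⟨d, τ, hτ, hτw, hτe⟩ := D.exists_runWeight_eq_eval (hlang ▸ hα)
    obtain rfl : d = d₀ := by simpa [hd₀] using hτ.1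
    have hsplit : τ.take π.length ++ τ.drop π.length = τ := List.take_append_drop _ _
    have hrun := hτ.2.1
    rw [← hsplit, isRun_append] at hrun
    have hlen : (word π).length = π.length := List.length_map _
    have hwτ : word (τ.take π.length) = word π := by
      rw [word, List.map_take]
      change (word τ).take π.length = _
      rw [hτw, word_append, ← hw, ← hlen, List.take_left]
    have hwτ' : word (τ.drop π.length) = word ρ' := by
      rw [word, List.map_drop]
      change (word τ).drop π.length = _
      rw [hτw, word_append, ← hw, ← hlen, List.drop_left]
    -- By determinism the accepting run of `D` on the completed word must begin with `π`.
    have hπτ := hD.run_unique hrun.1 hπ hwτ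
    rw [hπτ] at hrun hsplit
    refine ⟨τ.drop π.length, hrun.2, hwτ', by rwa [hsplit], ?_⟩
    rw [hsplit, hτe]
    have h1 := abs_le.1 (hreg _ hα)
    have h2 := N.runWeight_le_eval hacc
    linarith
  have bound : ∀ π, D.IsRun d₀ π → ∀ q₀ ∈ N.I, ∀ ρ, N.IsRun q₀ ρ → word π = word ρ →
      0 ≤ D.runWeight d₀ π - N.runWeight q₀ ρ + C := by
    intro π hπ q₀ hq₀ ρ hρ hw
    have hq := hκ (lastState q₀ ρ)
    obtain ⟨π', hπ', hw', -, hle⟩ := ext π hπ q₀ hq₀ ρ hρ hw _ hq.1 hq.2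
    rw [runWeight_append, runWeight_append] at hle
    have hlen : π'.length = (κ (lastState q₀ ρ)).length := by
      simpa [word] using congrArg List.length hw'
    have hlen' : (κ (lastState q₀ ρ)).length ≤ L :=
      Finset.le_sup (f := fun q => (κ q).length) (Finset.mem_univ _)
    obtain ⟨k1, k2⟩ := hh.isRun hπ'
    have h1 := N.abs_runWeight_le _ _ hq.1
    have h2 := N.abs_runWeight_le _ _ k1
    rw [k2, mapRun, List.length_map, hlen] at h2
    have h3 : ((κ (lastState q₀ ρ)).length : ℤ) * N.wMax ≤ (L * N.wMax : ℕ) := by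
      exact_mod_cast Nat.mul_le_mul_right _ hlen'
    have h4 := abs_le.1 (h1.trans h3)
    have h5 := abs_le.1 (h2.trans h3)
    have h6 : (C : ℤ) = r + 2 * (L * N.wMax : ℕ) := by rw [hC]; push_cast; ring
    linarith [h4.1, h5.2]
  have sim : N.IsSimulation fun p q e => ∃ π, D.IsRun d₀ π ∧ ∃ q₀ ∈ N.I, ∃ ρ, N.IsRun q₀ ρ ∧
      word π = word ρ ∧ h (lastState d₀ π) = p ∧ lastState q₀ ρ = q ∧
      (e : ℤ) = D.runWeight d₀ π - N.runWeight q₀ ρ + C := by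
    rintro p q e ⟨π, hπ, q₀, hq₀, ρ, hρ, hw, rfl, rfl, he⟩
    refine ⟨fun hF => ?_, ?_⟩
    · obtain ⟨π', -, hw', hacc, -⟩ := ext π hπ q₀ hq₀ ρ hρ hw [] trivial hF
      obtain rfl : π' = [] := by simpa [word] using hw'
      rw [List.append_nil] at hacc
      exact hh.final _ hacc.2.2
    · rintro a ⟨q', hq'⟩
      -- Since Adam's state can accept after `a`, so can the state of `D`; in particular it can read
      -- `a`.
      obtain ⟨π', hπ', hw', -, -⟩ := ext π hπ q₀ hq₀ ρ hρ hw ((a, q') :: κ q')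
        ⟨hq', (hκ q').1⟩ (hκ q').2
      obtain ⟨d', hd'⟩ : ∃ d', (lastState d₀ π, a, d') ∈ D.Δ := by
        cases π' with
        | nil => simp [word] at hw'
        | cons s π' =>
          obtain ⟨b, d'⟩ := s
          simp only [word, List.map_cons, List.cons.injEq] at hw'
          obtain ⟨rfl, -⟩ := hw'
          exact ⟨d', hπ'.1⟩
      have hπd : D.IsRun d₀ (π ++ [(a, d')]) := (isRun_concat _ _ _ _ _).2 ⟨hπ, hd'⟩
      have hword : ∀ (τ : List (A × Q)) x, word π = word τ →
          word (π ++ [(a, d')]) = word (τ ++ [(a, x)]) := by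
        intro τ x hτ
        rw [word_append, word_append, hτ]
        rfl
      refine ⟨h d', hh.trans _ _ _ hd', fun q'' hq'' => ?_, fun p'' hp'' => ?_⟩
      · have hρq : N.IsRun q₀ (ρ ++ [(a, q'')]) := (isRun_concat _ _ _ _ _).2 ⟨hρ, hq''⟩
        have hb := bound _ hπd q₀ hq₀ _ hρq (hword ρ q'' hw)
        refine ⟨_, ⟨_, hπd, q₀, hq₀, _, hρq, hword ρ q'' hw, by rw [lastState_concat],
          lastState_concat _ _ _ _, Int.toNat_of_nonneg hb⟩, ?_⟩
        rw [Int.toNat_of_nonneg hb, he, runWeight_concat, runWeight_concat,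
          hh.weight _ _ _ hd']
        linarith
      -- After a joker, Adam's run is the image of the run of `D` up to now, followed by `p''`;
      -- `bound` applies to it as to any initial run.
      · obtain ⟨k1, -⟩ := hh.isRun hπ
        have hρq : N.IsRun (h d₀) (mapRun h π ++ [(a, p'')]) :=
          (isRun_concat _ _ _ _ _).2 ⟨k1, by rwa [lastState_mapRun]⟩
        have hw₁ := hword (mapRun h π) p'' (word_mapRun h π).symm
        have hb := bound _ hπd _ (hh.init _ hd₀I) _ hρq hw₁
        exact ⟨_, _, hπd, _, hh.init _ hd₀I, _, hρq, hw₁, by rw [lastState_concat],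
          lastState_concat _ _ _ _, Int.toNat_of_nonneg hb⟩
  refine ⟨h d₀, hh.init _ hd₀I, fun q hq => Simulates.eveWinsFrom (e := C) ⟨_, sim, ?_⟩⟩
  exact ⟨[], trivial, q, hq, [], trivial, rfl, rfl, rfl, by simp [runWeight]⟩

end Regret

/-! ### Reduction to trim automata -/

section Trim

/-- The states that are reachable and can reach a final state. -/
def useful (N : WAut A Q) : Set Q :=
  {q | (∃ q₀ ∈ N.I, ∃ ρ, N.IsRun q₀ ρ ∧ lastState q₀ ρ = q) ∧
    ∃ ρ, N.IsRun q ρ ∧ lastState q ρ ∈ N.F}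

/-- The restriction of an automaton to its useful states. -/
def trim (N : WAut A Q) : WAut A N.useful where
  I := {q | q.1 ∈ N.I}
  Δ := {t | (t.1.1, t.2.1, t.2.2.1) ∈ N.Δ}
  w t := N.w (t.1.1, t.2.1, t.2.2.1)
  F := {q | q.1 ∈ N.F}

theorem isHom_trim (N : WAut A Q) : N.trim.IsHom N Subtype.val where
  init _ h := h
  final _ h := h
  trans _ _ _ h := h
  weight _ _ _ _ := rfl

theorem useful_step {N : WAut A Q} {q q' : Q} {a : A} (hq : q ∈ N.useful)
    (ht : (q, a, q') ∈ N.Δ) (h : ∃ ρ, N.IsRun q' ρ ∧ lastState q' ρ ∈ N.F) : q' ∈ N.useful := by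
  obtain ⟨⟨q₀, hq₀, ρ, hr, rfl⟩, -⟩ := hq
  exact ⟨⟨q₀, hq₀, ρ ++ [(a, q')], (isRun_concat _ _ _ _ _).2 ⟨hr, ht⟩,
    lastState_concat _ _ _ _⟩, h⟩

theorem exists_trim_run (N : WAut A Q) (q : N.useful) (ρ : List (A × Q)) (hr : N.IsRun q.1 ρ)
    (h : ∃ ρ', N.IsRun (lastState q.1 ρ) ρ' ∧ lastState (lastState q.1 ρ) ρ' ∈ N.F) :
    ∃ π, N.trim.IsRun q π ∧ mapRun Subtype.val π = ρ := by
  induction ρ generalizing q with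
  | nil => exact ⟨[], trivial, rfl⟩
  | cons s ρ ih =>
    obtain ⟨a, q'⟩ := s
    have hq' : q' ∈ N.useful := by
      obtain ⟨ρ', h1, h2⟩ := h
      exact useful_step q.2 hr.1 ⟨ρ ++ ρ', (isRun_append _ _ _ _).2 ⟨hr.2, h1⟩, by
        rw [lastState_append]
        exact h2⟩
    obtain ⟨π, h1, h2⟩ := ih ⟨q', hq'⟩ hr.2 h
    exact ⟨(a, ⟨q', hq'⟩) :: π, ⟨hr.1, h1⟩, by rw [← h2]; rfl⟩

theorem isTrim_trim (N : WAut A Q) : N.trim.IsTrim := by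
  rintro ⟨q, hq⟩
  obtain ⟨⟨q₀, hq₀, ρ, hr, rfl⟩, ρ', hr', hF⟩ := id hq
  constructor
  · have hu : q₀ ∈ N.useful := ⟨⟨q₀, hq₀, [], trivial, rfl⟩, ρ ++ ρ',
      (isRun_append _ _ _ _).2 ⟨hr, hr'⟩, by rwa [lastState_append]⟩
    obtain ⟨π, h1, rfl⟩ := N.exists_trim_run ⟨q₀, hu⟩ ρ hr ⟨ρ', hr', hF⟩
    exact ⟨⟨q₀, hu⟩, hq₀, π, h1, Subtype.ext (lastState_mapRun Subtype.val ⟨q₀, hu⟩ π).symm⟩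
  · obtain ⟨π, h1, h2⟩ := N.exists_trim_run ⟨_, hq⟩ ρ' hr' ⟨[], trivial, hF⟩
    refine ⟨π, h1, ?_⟩
    rw [← h2] at hF
    change lastState (Subtype.val (⟨_, hq⟩ : N.useful)) _ ∈ N.F at hF
    rw [lastState_mapRun] at hF
    exact hF

theorem values_trim (N : WAut A Q) (α : List A) : N.trim.values α = N.values α := by
  ext x
  constructor
  · rintro ⟨q, π, ⟨hI, hr, hF⟩, rfl, rfl⟩
    obtain ⟨h1, h2⟩ := N.isHom_trim.isRun hr
    exact ⟨q.1, _, ⟨hI, h1, by rw [lastState_mapRun]; exact hF⟩, word_mapRun _ _, h2⟩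
  · rintro ⟨q, ρ, ⟨hI, hr, hF⟩, rfl, rfl⟩
    have hu : q ∈ N.useful := ⟨⟨q, hI, [], trivial, rfl⟩, ρ, hr, hF⟩
    obtain ⟨π, h1, rfl⟩ := N.exists_trim_run ⟨q, hu⟩ ρ hr ⟨[], trivial, hF⟩
    obtain ⟨-, h2⟩ := N.isHom_trim.isRun h1
    refine ⟨⟨q, hu⟩, π, ⟨hI, h1, ?_⟩, (word_mapRun _ _).symm, h2.symm⟩
    change lastState (Subtype.val (⟨q, hu⟩ : N.useful)) _ ∈ N.F at hF
    rw [lastState_mapRun] at hF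
    exact hF

theorem language_trim (N : WAut A Q) : N.trim.language = N.language := by
  ext α
  rw [mem_language_iff, mem_language_iff, values_trim]

theorem eval_trim (N : WAut A Q) (α : List A) : N.trim.eval α = N.eval α :=
  eval_eq_of_values_eq (N.values_trim α)

/-- A nonempty language is what makes the initial state useful, so that it survives. -/
theorem IsDeterministic.trim {D : WAut A Q} (hD : D.IsDeterministic) (h : D.language.Nonempty) :
    D.trim.IsDeterministic := by
  obtain ⟨⟨d₀, hd₀⟩, hΔ⟩ := hD
  obtain ⟨α, d, ρ, ⟨hI, hr, hF⟩, -⟩ := h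
  obtain rfl : d = d₀ := by simpa [hd₀] using hI
  refine ⟨⟨⟨d, ⟨d, hI, [], trivial, rfl⟩, ρ, hr, hF⟩, ?_⟩,
    fun q a q₁ q₂ h₁ h₂ => Subtype.ext (hΔ _ _ _ _ h₁ h₂)⟩
  ext x
  have hx : x.1 ∈ D.I ↔ x.1 = d := by rw [hd₀, Set.mem_singleton_iff]
  exact ⟨fun h => Subtype.ext (hx.1 h), fun h => hx.2 (congrArg Subtype.val h)⟩

theorem IsHom.useful {D : WAut A Q'} {N : WAut A Q} {h : Q' → Q} (hh : D.IsHom N h) {d : Q'}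
    (hd : d ∈ D.useful) : h d ∈ N.useful := by
  obtain ⟨⟨d₀, hd₀, π, hπ, rfl⟩, π', hπ', hF⟩ := hd
  refine ⟨⟨h d₀, hh.init _ hd₀, _, (hh.isRun hπ).1, lastState_mapRun _ _ _⟩,
    _, (hh.isRun hπ').1, ?_⟩
  rw [lastState_mapRun]
  exact hh.final _ hF

/-- `D` is trimmed as well, since only its useful states are guaranteed to map to useful states of
`N`. -/
theorem IsRegretDeterminizable.trim {N : WAut A Q} {r : ℕ} (h : N.IsRegretDeterminizable r)
    (hne : N.language.Nonempty) : N.trim.IsRegretDeterminizable r := by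
  classical
  obtain ⟨Q', _, D, hD, ⟨h, hh⟩, hlang, hreg⟩ := h
  refine ⟨D.useful, Fintype.ofFinite _, D.trim, hD.trim (hlang ▸ hne),
    ⟨fun d => ⟨h d.1, hh.useful d.2⟩, ?_⟩, ?_, fun α hα => ?_⟩
  · exact ⟨fun q hq => hh.init _ hq, fun q hq => hh.final _ hq,
      fun p a q ht => hh.trans _ _ _ ht, fun p a q ht => hh.weight _ _ _ ht⟩
  · rw [language_trim, language_trim, hlang]
  · rw [language_trim] at hα
    rw [eval_trim, eval_trim]
    exact hreg α hα

/-- Treated apart, because trimming would leave no initial state. -/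
theorem isDeterminizable_of_language_eq_empty {N : WAut A Q} (h : N.language = ∅) :
    N.IsDeterminizable := by
  refine ⟨Unit, inferInstance, ⟨Set.univ, ∅, fun _ => 0, ∅⟩,
    ⟨⟨(), Set.eq_univ_of_forall (fun _ => rfl) |>.symm⟩, fun _ _ _ _ h => h.elim⟩, ?_, ?_⟩
  · rw [h]
    refine (Set.eq_empty_of_forall_notMem ?_).symm
    rintro α ⟨q, ρ, hacc, -⟩
    exact hacc.2.2
  · rw [h]
    exact fun _ h => h.elim

theorem IsApproxHomDeterminizable.isDeterminizable [Fintype A] [Fintype Q] {N : WAut A Q}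
    (h : N.IsApproxHomDeterminizable) : N.IsDeterminizable := by
  classical
  rcases N.language.eq_empty_or_nonempty with he | hne
  · exact isDeterminizable_of_language_eq_empty he
  obtain ⟨r, hr⟩ := h
  let _ : Fintype N.useful := Fintype.ofFinite _
  obtain ⟨Q', hQ', D, hD, ⟨h1, h2⟩, -⟩ :=
    ((hr.trim hne).eveWinsJoker N.isTrim_trim).isBounded N.isTrim_trim |>.exists_deterministic
  rw [language_trim] at h1 h2
  exact ⟨Q', hQ', D, hD, h1, fun α hα => by rw [← h2 α hα, eval_trim]⟩

end Trim

end WAut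

/-! ### The main theorem -/

theorem mainTheorem7 :
    -- the polynomial depends on nothing: it is the same for all alphabets and automata
    (∃ P : MvPolynomial (Fin 2) ℕ,
      ∀ (A : Type u) (Q : Type v) [Fintype A] [Fintype Q] (N : WAut A Q),
        N.IsTrim → N.EveWinsJoker →
          N.IsBounded (2 * (Fintype.card (JokerVertex A Q) * N.jokerGame.μMax)) ∧
          ∃ (Q' : Type) (_ : Fintype Q') (D : WAut A Q'),
            D.IsDeterministic ∧ N.Equivalent D ∧
            Fintype.card Q' ≤ (P.eval ![Fintype.card Q, N.wMax]) ^ Fintype.card Q ∧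
            D.Δ.ncard ≤ Fintype.card A * (P.eval ![Fintype.card Q, N.wMax]) ^ Fintype.card Q ∧
            D.wMax ≤ P.eval ![Fintype.card Q, N.wMax]) ∧
    (∀ (A : Type u) (Q : Type v) [Fintype A] [Fintype Q] (N : WAut A Q),
      N.IsTrim → ∀ r : ℕ, N.IsRegretDeterminizable r → N.EveWinsJoker) ∧
    (∀ (A : Type u) (Q : Type v) [Fintype A] [Fintype Q] (N : WAut A Q),
      N.IsApproxHomDeterminizable → N.IsDeterminizable) := by
  -- With B = 2|Q|²μ_max and μ_max ≤ 2w_max + 1, this dominates both 2B + 2, the number of values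
  -- per state, and B + w_max, the weight bound.
  refine ⟨⟨.C 4 * .X 0 ^ 2 * (.C 2 * .X 1 + .C 1) + .X 1 + .C 2, ?_⟩,
    fun A Q _ _ N hN r h => h.eveWinsJoker hN, fun A Q _ _ N h => h.isDeterminizable⟩
  intro A Q _ _ N hN hW
  have hB := hW.isBounded hN
  have hμ : Fintype.card Q ^ 2 * N.jokerGame.μMax ≤ Fintype.card Q ^ 2 * (2 * N.wMax + 1) :=
    Nat.mul_le_mul_left _ N.μMax_le
  have hV : Fintype.card Q ^ 2 ≤ Fintype.card (JokerVertex A Q) :=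
    (Nat.le_succ _).trans WAut.card_sq_add_one_le
  refine ⟨hB.mono (Nat.mul_le_mul_left _ (Nat.mul_le_mul_right _ hV)), ?_⟩
  obtain ⟨Q', hQ', D, hD, hE, h1, h2, h3⟩ := hB.exists_deterministic
  have hP : MvPolynomial.eval ![Fintype.card Q, N.wMax]
      (.C 4 * .X 0 ^ 2 * (.C 2 * .X 1 + .C 1) + .X 1 + .C 2 : MvPolynomial (Fin 2) ℕ) =
      4 * (Fintype.card Q ^ 2 * (2 * N.wMax + 1)) + N.wMax + 2 := by
    simp only [map_add, map_mul, map_pow, MvPolynomial.eval_C, MvPolynomial.eval_X,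
      Matrix.cons_val_zero, Matrix.cons_val_one, mul_assoc]
  rw [hP]
  have hpow := Nat.pow_le_pow_left (show 2 * (2 * (Fintype.card Q ^ 2 * N.jokerGame.μMax)) + 2 ≤
    4 * (Fintype.card Q ^ 2 * (2 * N.wMax + 1)) + N.wMax + 2 by omega) (Fintype.card Q)
  exact ⟨Q', hQ', D, hD, hE, h1.trans hpow, h2.trans (Nat.mul_le_mul_left _ hpow),
    h3.trans (by omega)⟩
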